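/- There is an absolute constant $C>0$ such that the following holds. Consider a packing LP with $m$ resources, $n$ requests and $K$ options per request, $$\max \sum_{j\in[n]}\sum_{k\in[K]} c_{j,k}x_{j,k}\quad\text{s.t.}\quad \sum_{j,k} a_{i,j,k}x_{j,k}\le b_i\ (i\in[m]),\qquad \sum_{k} x_{j,k}\le 1\ (j\in[n]),\qquad x\ge 0,$$ with $a_{i,j,k},b_i,c_{j,k}\ge 0$, and let $\mathrm{OPT}$ be its (fractional) optimal value. Suppose that every column $(a_{i,j,k})_{i\in[m]}$ of the constraint matrix has at most $d$ nonzero entries, and that $0<B\le \min_i \frac{b_i}{\max_{j,k}a_{i,j,k}}$, the minimum being over the rows $i$ that have a nonzero entry (the minimum is $+\infty$ if there is no such row). The requests arrive in uniformly random order, and the following algorithm is run, starting with the allocation $y=0$. When the $\ell$-th request $j$ arrives, let $S$ be the set of the $\ell$ requests seen so far (including $j$), and let $\tilde x^{(\ell)}$ be an optimal solution of the LP in which all capacities $b_i$ are replaced by $\frac{\ell}{n}b_i$ and $x_{j',k}=0$ for $j'\notin S$; ties between optimal solutions are broken by an arbitrary rule that depends only on the set $S$, not on the order in which the requests in $S$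 arrived. With fresh randomness, choose at most one option for $j$, option $k$ with probability $\tilde x^{(\ell)}_{j,k}$ and none with probability $1-\sum_k\tilde x^{(\ell)}_{j,k}$. If allocating the chosen option in addition to $y$ respects all the original capacities $b_i$, then it is permanently added to $y$; otherwise request $j$ is discarded. Let $\mathrm{ALG}$ be the profit of the final allocation. Then the final allocation is always a feasible integral solution of the LP, and $$\mathbb E[\mathrm{ALG}]\ \ge\ \Bigl(1-C\sqrt{\tfrac{\log d}{B}}\Bigr)\,\mathrm{OPT},$$ where $\log d$ denotes $\max\{\log_2 d,1\}$ (and $\log 0$ is taken to be $1$), and the expectation is over the arrival order and the random rounding. -/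

import Mathlib

open scoped ENNReal

noncomputable section

/-- A packing LP with `m` resources, `n` requests and `K` options per request.
`profit j k` is `c_{j,k}`, `demand i j k` is `a_{i,j,k}`, `capacity i` is `b_i`. -/
structure PackingLP (m n K : ℕ) where
  profit : Fin n → Fin K → ℝ
  demand : Fin m → Fin n → Fin K → ℝ
  capacity : Fin m → ℝ
  profit_nonneg : ∀ j k, 0 ≤ profit j k
  demand_nonneg : ∀ i j k, 0 ≤ demand i j k
  capacity_nonneg : ∀ i, 0 ≤ capacity i

namespace PackingLP

variable {m n K : ℕ} (I : PackingLP m n K)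

/-- The objective `c^T x`. -/
def value (x : Fin n → Fin K → ℝ) : ℝ := ∑ j, ∑ k, I.profit j k * x j k

/-- The consumption `(A x)_i` of resource `i`. -/
def usage (x : Fin n → Fin K → ℝ) (i : Fin m) : ℝ := ∑ j, ∑ k, I.demand i j k * x j k

/-- `P(f, S)`: the fractional solutions of the LP with capacities scaled by `f` in which only
requests from `S` are served. -/
def feasible (f : ℝ) (S : Finset (Fin n)) : Set (Fin n → Fin K → ℝ) :=
  {x | (∀ i, I.usage x i ≤ f * I.capacity i) ∧ (∀ j k, 0 ≤ x j k) ∧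
    (∀ j ∈ S, ∑ k, x j k ≤ 1) ∧ ∀ j ∉ S, ∀ k, x j k = 0}

/-- `x` is an optimal solution of `max_{x ∈ P(f, S)} c^T x`. -/
def IsOptimal (f : ℝ) (S : Finset (Fin n)) (x : Fin n → Fin K → ℝ) : Prop :=
  x ∈ I.feasible f S ∧ ∀ z ∈ I.feasible f S, I.value z ≤ I.value x

/-- `OPT`, the optimal value of the fractional LP. -/
def opt : ℝ := sSup (I.value '' I.feasible 1 Finset.univ)

/-- Every column of the constraint matrix has at most `d` nonzero entries. -/
def ColumnSparse (d : ℕ) : Prop :=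
  ∀ j k, (Finset.univ.filter fun i => I.demand i j k ≠ 0).card ≤ d

/-- `max_{j,k} a_{i,j,k}`. -/
def maxDemand (i : Fin m) : ℝ := ⨆ p : Fin n × Fin K, I.demand i p.1 p.2

/-- The capacity ratio `min_i b_i / max_{j,k} a_{i,j,k}`, where the minimum is over the rows that
have a nonzero entry; it is `⊤` if the constraint matrix is zero. -/
def capacityRatio : EReal :=
  ⨅ i, ⨅ _ : 0 < I.maxDemand i, ((I.capacity i / I.maxDemand i : ℝ) : EReal)

/-- The scaled LPs have optimal solutions. -/
theorem exists_isOptimal {f : ℝ} (hf : 0 ≤ f) (S : Finset (Fin n)) :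
    ∃ x, I.IsOptimal f S x := by
  have hsub : I.feasible f S ⊆ Set.Icc 0 1 := by
    rintro x ⟨-, h0, h1, h2⟩
    refine ⟨fun j k => h0 j k, fun j k => ?_⟩
    by_cases hj : j ∈ S
    · exact (Finset.single_le_sum (fun k _ => h0 j k) (Finset.mem_univ k)).trans (h1 j hj)
    · simp [h2 j hj k]
  have husage : ∀ i, Continuous fun x => I.usage x i := by
    intro i; unfold usage; fun_prop
  have hvalue : Continuous I.value := by
    unfold value; fun_prop
  have hclosed : IsClosed (I.feasible f S) := by
    simp only [feasible, Set.ofPred_and, Set.ofPred_forall]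
    refine (isClosed_iInter fun i => isClosed_le (husage i) continuous_const).inter
      ((isClosed_iInter fun j => isClosed_iInter fun k =>
        isClosed_le continuous_const (by fun_prop)).inter
      ((isClosed_iInter fun j => isClosed_iInter fun _ =>
        isClosed_le (by fun_prop) continuous_const).inter
      (isClosed_iInter fun j => isClosed_iInter fun _ => isClosed_iInter fun k =>
        isClosed_eq (by fun_prop) continuous_const)))
  have hne : (I.feasible f S).Nonempty := by
    refine ⟨0, fun i => ?_, by simp, by simp, by simp⟩
    simpa [usage] using mul_nonneg hf (I.capacity_nonneg i)
  obtain ⟨x, hx, hmax⟩ :=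
    (isCompact_Icc.of_isClosed_subset hclosed hsub).exists_isMaxOn hne hvalue.continuousOn
  exact ⟨x, hx, fun z hz => hmax hz⟩

/-- An LP solver: for every set `S` of known requests it returns an optimal solution of the LP
restricted to `S` with capacities scaled by `|S| / n`. Which optimal solution is returned may depend
on the set `S`, but not on the order in which the requests in `S` arrived. -/
structure Solver where
  solution : Finset (Fin n) → Fin n → Fin K → ℝ
  isOptimal : ∀ S, I.IsOptimal ((S.card : ℝ) / n) S (solution S)

/-- An integral allocation selects at most one option for each request; `toVector y` is the
corresponding 0/1 vector. -/
def toVector (y : Fin n → Option (Fin K)) : Fin n → Fin K → ℝ :=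
  fun j k => if y j = some k then 1 else 0

variable {I}

theorem Solver.solution_nonneg (sol : I.Solver) (S : Finset (Fin n)) (j : Fin n) (k : Fin K) :
    0 ≤ sol.solution S j k := (sol.isOptimal S).1.2.1 j k

theorem Solver.sum_solution_le_one (sol : I.Solver) (S : Finset (Fin n)) (j : Fin n) :
    ∑ k, sol.solution S j k ≤ 1 := by
  by_cases hj : j ∈ S
  · exact (sol.isOptimal S).1.2.2.1 j hj
  · simp [(sol.isOptimal S).1.2.2.2 j hj]

/-- Randomized rounding of the fractional allocation of request `j`: option `k` is chosen with
probability `x_{j,k}`, and no option with the remaining probability. -/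
def Solver.round (sol : I.Solver) (S : Finset (Fin n)) (j : Fin n) : PMF (Option (Fin K)) :=
  PMF.ofFintype
    (fun o => o.elim (ENNReal.ofReal (1 - ∑ k, sol.solution S j k))
      fun k => ENNReal.ofReal (sol.solution S j k))
    (by
      rw [Fintype.sum_option]
      simp only [Option.elim]
      rw [← ENNReal.ofReal_sum_of_nonneg fun k _ => sol.solution_nonneg S j k,
        ← ENNReal.ofReal_add (sub_nonneg.2 (sol.sum_solution_le_one S j))
          (Finset.sum_nonneg fun k _ => sol.solution_nonneg S j k)]
      simp)

open scoped Classical in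
/-- One step of the algorithm: request `j` arrives, `S` is the set of known requests (with `j`), `y`
is the current allocation. The tentative option for `j` is kept if the resulting allocation respects
the unscaled capacities. -/
def Solver.step (sol : I.Solver) (S : Finset (Fin n)) (j : Fin n) (y : Fin n → Option (Fin K)) :
    PMF (Fin n → Option (Fin K)) :=
  (sol.round S j).map fun o =>
    if ∀ i, I.usage (toVector (Function.update y j o)) i ≤ I.capacity i
    then Function.update y j o else y

/-- The first `l` requests in the arrival order `π`, where `π t` is the request arriving at
(zero-based) position `t`. -/
def arrived (π : Equiv.Perm (Fin n)) (l : ℕ) : Finset (Fin n) :=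
  Finset.univ.filter fun j => (π.symm j : ℕ) < l

/-- The law of the allocation after the first `l` steps, for a fixed arrival order `π`. -/
def Solver.run (sol : I.Solver) (π : Equiv.Perm (Fin n)) : ℕ → PMF (Fin n → Option (Fin K))
  | 0 => PMF.pure fun _ => none
  | l + 1 =>
    if h : l < n then (sol.run π l).bind (sol.step (arrived π (l + 1)) (π ⟨l, h⟩))
    else sol.run π l

/-- The law of the output of the algorithm when the requests arrive in uniformly random order. -/
def Solver.output (sol : I.Solver) : PMF (Fin n → Option (Fin K)) :=
  (PMF.uniformOfFintype (Equiv.Perm (Fin n))).bind fun π => sol.run π n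

/-- `E[ALG]`, the expected profit of the output. -/
def Solver.expectedProfit (sol : I.Solver) : ℝ :=
  ∑ y, (sol.output y).toReal * I.value (toVector y)

end PackingLP

/-- The convention `log k = max {log₂ k, 1}`. -/
def log2Max (k : ℕ) : ℝ := max (Real.logb 2 k) 1

end

/-!
A fractional solution `x` of the LP for the whole instance, restricted to a random sample `S` of
`l + 1` requests, uses each resource to about the fraction `(l + 1) / n`. Scaling down every option
according to the most overloaded of the at most `d` resources it needs makes it feasible for the
sample, at an expected relative loss of order `√(log d * n / (B * l))`
(`PackingLP.Solver.le_sum_perm_value_solution`). The exponential moments required here are those of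
sampling without replacement; they are bounded by those of sampling with replacement by exchanging
two positions of the arrival order (`PackingLP.sum_perm_prod_succ_le`). Summed over the steps, the
relative loss is of order `√(log d / B)`.

Given the set of the first `l + 1` requests, the last of them is uniformly random in that set, so
the tentative choice for it is worth in expectation `1 / (l + 1)` of the fractional optimum for the
set. The choice may be rejected, but only because of one of the at most `d` resources it needs. Read
backwards in time, each earlier request is likewise uniform in the set known when it arrives, so it
consumes in expectation at most `1 / n` of each capacity, whatever the later sets and choices are.
This gives a Chernoff bound for the consumption (`PackingLP.Solver.orderMean_exp_usage_le`) and
rejection probabilities of order `d * exp (-(1 - l / n) ^ 2 * B / 4)`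
(`PackingLP.Solver.orderMean_rejection_le`), whose average over `l`, capped at `1`, is again of
order `√(log d / B)` (`PackingLP.sum_rejectionBound_le`).

The backward view is encoded in `PackingLP.Solver.orderMean`, a recursion over the last request of a
set. It agrees with the algorithm on average over the arrival order
(`PackingLP.Solver.sum_perm_run`), by symmetrizing over exchanges of two positions.
-/

noncomputable section

namespace PackingLP

variable {m n K : ℕ} {I : PackingLP m n K}

/-! ### Symmetrization over arrival orders -/

theorem sum_perm_mul_swap (F : Equiv.Perm (Fin n) → ℝ) (s t : Fin n) :
    ∑ π, F (π * Equiv.swap s t) = ∑ π, F π :=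
  Equiv.sum_comp (Equiv.mulRight (Equiv.swap s t)) F

theorem mem_arrived {π : Equiv.Perm (Fin n)} {l : ℕ} {j : Fin n} :
    j ∈ arrived π l ↔ (π.symm j : ℕ) < l := by
  simp [arrived]

theorem arrived_mul_swap (π : Equiv.Perm (Fin n)) {l : ℕ} {s t : Fin n}
    (hs : (s : ℕ) < l) (ht : (t : ℕ) < l) :
    arrived (π * Equiv.swap s t) l = arrived π l := by
  ext j
  have h : (π * Equiv.swap s t).symm j = Equiv.swap s t (π.symm j) := by
    rw [Equiv.symm_apply_eq]; simp
  rw [mem_arrived, mem_arrived, h, Equiv.swap_apply_def]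
  split_ifs with h1 h2
  · rw [h1]; exact ⟨fun _ => hs, fun _ => ht⟩
  · rw [h2]; exact ⟨fun _ => ht, fun _ => hs⟩
  · rfl

/-- The first `l` positions of an arrival order. -/
def positions (n l : ℕ) : Finset (Fin n) := Finset.univ.filter fun t : Fin n => (t : ℕ) < l

theorem mem_positions {l : ℕ} {t : Fin n} : t ∈ positions n l ↔ (t : ℕ) < l := by
  simp [positions]

theorem arrived_eq_map (π : Equiv.Perm (Fin n)) (l : ℕ) :
    arrived π l = (positions n l).map π.toEmbedding := by
  ext j
  simp only [mem_arrived, Finset.mem_map_equiv, mem_positions]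

theorem card_positions {l : ℕ} (hl : l ≤ n) :
    (positions n l).card = l := by
  rw [positions, Fin.card_filter_val_lt, min_eq_right hl]

theorem card_arrived (π : Equiv.Perm (Fin n)) {l : ℕ} (hl : l ≤ n) : (arrived π l).card = l := by
  rw [arrived_eq_map, Finset.card_map, card_positions hl]

theorem arrived_succ_erase (π : Equiv.Perm (Fin n)) {l : ℕ} (hl : l < n) :
    (arrived π (l + 1)).erase (π ⟨l, hl⟩) = arrived π l := by
  ext j
  rw [Finset.mem_erase, mem_arrived, mem_arrived, Ne, ← Equiv.symm_apply_eq, Fin.ext_iff]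
  simp only []
  omega

theorem arrived_eq_univ (π : Equiv.Perm (Fin n)) : arrived π n = Finset.univ := by
  ext j; simp [mem_arrived]

/-- In a uniformly random arrival order, the last of the first `l + 1` requests is a uniformly
random element of the set they form, even given that set and all later arrivals. -/
theorem sum_perm_sum_arrived (Θ : Equiv.Perm (Fin n) → Fin n → ℝ) {l : ℕ} (hl : l < n)
    (hΘ : ∀ π (s : Fin n), (s : ℕ) < l + 1 → Θ (π * Equiv.swap s ⟨l, hl⟩) = Θ π) :
    ∑ π, ∑ j ∈ arrived π (l + 1), Θ π j = (l + 1) * ∑ π : Equiv.Perm (Fin n), Θ π (π ⟨l, hl⟩) := by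
  have h1 : ∀ s : Fin n, (s : ℕ) < l + 1 →
      ∑ π : Equiv.Perm (Fin n), Θ π (π s) = ∑ π : Equiv.Perm (Fin n), Θ π (π ⟨l, hl⟩) := by
    intro s hs
    rw [← sum_perm_mul_swap (fun π => Θ π (π s)) s ⟨l, hl⟩]
    refine Finset.sum_congr rfl fun π _ => ?_
    rw [hΘ π s hs]; simp
  simp_rw [arrived_eq_map, Finset.sum_map, Equiv.coe_toEmbedding]
  rw [Finset.sum_comm, Finset.sum_congr rfl fun s hs => h1 s (mem_positions.1 hs),
    Finset.sum_const, card_positions hl, nsmul_eq_mul]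
  push_cast; rfl

theorem sum_perm_apply (f : Fin n → ℝ) (t : Fin n) :
    n * ∑ π : Equiv.Perm (Fin n), f (π t) = n.factorial * ∑ j, f j := by
  have h1 : ∀ s : Fin n, ∑ π : Equiv.Perm (Fin n), f (π s) = ∑ π : Equiv.Perm (Fin n), f (π t) := by
    intro s
    rw [← sum_perm_mul_swap (fun π => f (π s)) s t]
    simp
  have h2 : ∑ s : Fin n, ∑ π : Equiv.Perm (Fin n), f (π s)
      = n * ∑ π : Equiv.Perm (Fin n), f (π t) := by
    rw [Finset.sum_congr rfl fun s _ => h1 s]; simp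
  rw [← h2, Finset.sum_comm, Finset.sum_congr rfl fun π _ => Equiv.sum_comp π f]
  simp [Fintype.card_perm]

/-! ### Sampling without replacement -/

/-- One step of Maclaurin's inequality: for sampling without replacement, a further factor is on
average at most the mean over all positions other than `l`. The weight `h (π l)` conditions on the
request at position `l`. -/
theorem sum_perm_prod_succ_le (h w : Fin n → ℝ) (hh : ∀ j, 0 ≤ h j) (hw : ∀ j, 0 ≤ w j)
    {k : ℕ} {l : Fin n} (hkl : k < l) :
    (n - 1) * ∑ π : Equiv.Perm (Fin n), h (π l) *
        ∏ t ∈ positions n (k + 1), w (π t) ≤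
      ∑ π : Equiv.Perm (Fin n), h (π l) * (∏ t ∈ positions n k, w (π t)) *
        ∑ q ∈ Finset.univ.erase l, w (π q) := by
  set P : Finset (Fin n) := positions n k with hP
  let q0 : Fin n := ⟨k, hkl.trans l.2⟩
  have hq0 : q0 ∉ P := by simp [hP, q0, mem_positions]
  have hq0l : q0 ≠ l := by simp [q0, Fin.ext_iff]; omega
  have hsucc : positions n (k + 1) = insert q0 P := by
    ext t
    simp only [hP, q0, mem_positions, Finset.mem_insert, Fin.ext_iff]
    omega
  have key : ∀ q ∈ Finset.univ.erase l,
      ∑ π : Equiv.Perm (Fin n), h (π l) * ((∏ t ∈ P, w (π t)) * w (π q0)) ≤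
        ∑ π : Equiv.Perm (Fin n), h (π l) * ((∏ t ∈ P, w (π t)) * w (π q)) := by
    intro q hq
    have hql : q ≠ l := Finset.ne_of_mem_erase hq
    by_cases hqP : q ∈ P
    · -- Averaging over the exchange of the positions `q` and `q0` leaves a square.
      have hqq : q ≠ q0 := fun e => hq0 (e ▸ hqP)
      let D : Equiv.Perm (Fin n) → ℝ := fun π =>
        h (π l) * ((∏ t ∈ P, w (π t)) * (w (π q) - w (π q0)))
      have hD : 0 ≤ ∑ π, D π := by
        have h2 : 0 ≤ ∑ π, (D π + D (π * Equiv.swap q q0)) := by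
          refine Finset.sum_nonneg fun π _ => ?_
          have e1 : (π * Equiv.swap q q0) l = π l := by
            simp [Equiv.swap_apply_of_ne_of_ne hql.symm hq0l.symm]
          have e2 : ∏ t ∈ P, w ((π * Equiv.swap q q0) t) =
              w (π q0) * ∏ t ∈ P.erase q, w (π t) := by
            rw [← Finset.mul_prod_erase _ _ hqP]
            congr 1
            · simp
            · refine Finset.prod_congr rfl fun t ht => ?_
              rw [Equiv.Perm.mul_apply, Equiv.swap_apply_of_ne_of_ne (Finset.ne_of_mem_erase ht)]
              rintro rfl
              exact hq0 (Finset.mem_of_mem_erase ht)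
          have e3 : D π + D (π * Equiv.swap q q0) =
              h (π l) * ((∏ t ∈ P.erase q, w (π t)) * (w (π q) - w (π q0)) ^ 2) := by
            simp only [D]
            rw [e1, e2, ← Finset.mul_prod_erase _ _ hqP]
            simp only [Equiv.Perm.mul_apply, Equiv.swap_apply_left, Equiv.swap_apply_right]
            ring
          rw [e3]
          exact mul_nonneg (hh _) (mul_nonneg (Finset.prod_nonneg fun _ _ => hw _) (sq_nonneg _))
        rw [Finset.sum_add_distrib, sum_perm_mul_swap D] at h2
        linarith
      rw [← sub_nonneg, ← Finset.sum_sub_distrib]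
      refine hD.trans_eq (Finset.sum_congr rfl fun π _ => ?_)
      simp only [D]; ring
    · rw [← sum_perm_mul_swap (fun π => h (π l) * ((∏ t ∈ P, w (π t)) * w (π q0))) q q0]
      refine (Finset.sum_congr rfl fun π _ => ?_).le
      have e1 : (π * Equiv.swap q q0) l = π l := by
        simp [Equiv.swap_apply_of_ne_of_ne hql.symm hq0l.symm]
      have e2 : ∏ t ∈ P, w ((π * Equiv.swap q q0) t) = ∏ t ∈ P, w (π t) := by
        refine Finset.prod_congr rfl fun t ht => ?_
        rw [Equiv.Perm.mul_apply, Equiv.swap_apply_of_ne_of_ne]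
        · rintro rfl; exact hqP ht
        · rintro rfl; exact hq0 ht
      rw [e1, e2]; simp
  have hcard : ((Finset.univ.erase l).card : ℝ) = n - 1 := by
    rw [Finset.card_erase_of_mem (Finset.mem_univ l), Finset.card_fin, Nat.cast_sub (by omega)]
    simp
  have hsum := Finset.sum_le_sum key
  rw [Finset.sum_const, nsmul_eq_mul, hcard, Finset.sum_comm] at hsum
  simp_rw [hsucc, Finset.prod_insert hq0, Finset.mul_sum]
  simp_rw [Finset.mul_sum] at hsum
  refine (le_of_eq ?_).trans (hsum.trans (le_of_eq ?_))
  · exact Finset.sum_congr rfl fun π _ => by ring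
  · exact Finset.sum_congr rfl fun π _ => Finset.sum_congr rfl fun q _ => by ring

theorem exp_mul_le_of_mem_Icc {x : ℝ} (h0 : 0 ≤ x) (h1 : x ≤ 1) (μ : ℝ) :
    Real.exp (μ * x) ≤ 1 + (Real.exp μ - 1) * x := by
  have h := convexOn_exp.2 (Set.mem_univ 0) (Set.mem_univ μ) (sub_nonneg.2 h1) h0 (by ring)
  simp only [smul_eq_mul, mul_zero, zero_add, Real.exp_zero, mul_one] at h
  rw [mul_comm μ x]
  linarith

/-- The moment generating function of a sum sampled without replacement, with a weight depending
on the request at position `l`. -/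
theorem sum_perm_exp_le (h u : Fin n → ℝ) (hh : ∀ j, 0 ≤ h j) (hu0 : ∀ j, 0 ≤ u j)
    (hu1 : ∀ j, u j ≤ 1) {β μ : ℝ} (hβ : ∑ j, u j ≤ β) (hμ : 0 ≤ μ) (l : Fin n) :
    ∑ π : Equiv.Perm (Fin n), h (π l) * Real.exp (μ * ∑ t ∈ positions n l, u (π t)) ≤
      Real.exp ((l + 1 : ℝ) / n * β * (Real.exp μ - 1)) *
        ∑ π : Equiv.Perm (Fin n), h (π l) := by
  have hβ0 : 0 ≤ β := (Finset.sum_nonneg fun j _ => hu0 j).trans hβ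
  have he : 0 ≤ Real.exp μ - 1 := by linarith [Real.add_one_le_exp μ]
  set w : Fin n → ℝ := fun j => Real.exp (μ * u j) with hw
  have hw0 : ∀ j, 0 ≤ w j := fun j => (Real.exp_pos _).le
  set c : ℝ := Real.exp (β * (Real.exp μ - 1) / (n - 1)) with hc
  have hstep : ∀ k : ℕ, k ≤ l → ∑ π : Equiv.Perm (Fin n), h (π l) *
      ∏ t ∈ positions n k, w (π t) ≤ c ^ k * ∑ π : Equiv.Perm (Fin n), h (π l) := by
    intro k
    induction k with
    | zero => simp [positions]
    | succ k ih =>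
      intro hk
      have hn : (0 : ℝ) < n - 1 := by
        have : (2 : ℝ) ≤ n := by exact_mod_cast (show 2 ≤ n by have := l.2; omega)
        linarith
      have h1 := sum_perm_prod_succ_le h w hh hw0 (k := k) (l := l) (by omega)
      have h2 : ∑ π : Equiv.Perm (Fin n), h (π l) * (∏ t ∈ positions n k, w (π t)) *
          ∑ q ∈ Finset.univ.erase l, w (π q) ≤ ∑ π : Equiv.Perm (Fin n),
          h (π l) * (∏ t ∈ positions n k, w (π t)) * ((n - 1) * c) := by
        refine Finset.sum_le_sum fun π _ => mul_le_mul_of_nonneg_left ?_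
          (mul_nonneg (hh _) (Finset.prod_nonneg fun _ _ => hw0 _))
        have hle : ∑ q ∈ Finset.univ.erase l, w (π q) ≤
            ∑ q ∈ Finset.univ.erase l, (1 + (Real.exp μ - 1) * u (π q)) :=
          Finset.sum_le_sum fun q _ => exp_mul_le_of_mem_Icc (hu0 _) (hu1 _) μ
        have hub : ∑ q ∈ Finset.univ.erase l, u (π q) ≤ β := by
          refine le_trans ?_ hβ
          rw [← Equiv.sum_comp π u]
          exact Finset.sum_le_sum_of_subset_of_nonneg (Finset.subset_univ _) fun _ _ _ => hu0 _
        have hcard : ((Finset.univ.erase l).card : ℝ) = n - 1 := by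
          rw [Finset.card_erase_of_mem (Finset.mem_univ l), Finset.card_fin,
            Nat.cast_sub (by have := l.2; omega)]
          simp
        rw [Finset.sum_add_distrib, Finset.sum_const, nsmul_eq_mul, hcard, mul_one,
          ← Finset.mul_sum] at hle
        have h3 : (n - 1) * (β * (Real.exp μ - 1) / (n - 1) + 1) ≤ (n - 1) * c :=
          mul_le_mul_of_nonneg_left (Real.add_one_le_exp _) hn.le
        have h4 : (n - 1 : ℝ) * (β * (Real.exp μ - 1) / (n - 1) + 1)
            = β * (Real.exp μ - 1) + (n - 1) := by field_simp
        nlinarith [mul_le_mul_of_nonneg_left hub he]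
      rw [← Finset.sum_mul] at h2
      have h5 := h1.trans h2
      have h6 : ∑ π : Equiv.Perm (Fin n), h (π l) * ∏ t ∈ positions n (k + 1), w (π t) ≤
          c * ∑ π : Equiv.Perm (Fin n), h (π l) * ∏ t ∈ positions n k, w (π t) := by
        refine le_of_mul_le_mul_left (h5.trans (le_of_eq ?_)) hn
        ring
      refine h6.trans ((mul_le_mul_of_nonneg_left (ih (by omega)) (Real.exp_pos _).le).trans
        (le_of_eq ?_))
      ring
  have hfin := hstep l le_rfl
  have hprod : ∀ π : Equiv.Perm (Fin n), ∏ t ∈ positions n l, w (π t) =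
      Real.exp (μ * ∑ t ∈ positions n l, u (π t)) := by
    intro π
    rw [Finset.mul_sum, Real.exp_sum]
  simp_rw [hprod] at hfin
  refine hfin.trans (mul_le_mul_of_nonneg_right ?_ (Finset.sum_nonneg fun _ _ => hh _))
  rw [hc, ← Real.exp_nat_mul, Real.exp_le_exp]
  have hln : (l : ℝ) + 1 ≤ n := by exact_mod_cast l.2
  have hl0 : (0 : ℝ) ≤ (l : ℕ) := Nat.cast_nonneg _
  have hle : (l : ℝ) / (n - 1) ≤ (l + 1) / n := by
    rcases hl0.eq_or_lt with h0 | h0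
    · rw [← h0]; simp
    · rw [div_le_div_iff₀ (by linarith) (by linarith)]
      nlinarith
  calc (l : ℝ) * (β * (Real.exp μ - 1) / (n - 1)) = l / (n - 1) * (β * (Real.exp μ - 1)) := by ring
    _ ≤ (l + 1) / n * (β * (Real.exp μ - 1)) :=
        mul_le_mul_of_nonneg_right hle (mul_nonneg hβ0 he)
    _ = _ := by ring

/-! ### The law of the allocation given the set of known requests -/

/-- The expectation of `g` under a law on a finite type. -/
def pmfMean {α : Type*} [Fintype α] (p : PMF α) (g : α → ℝ) : ℝ := ∑ a, (p a).toReal * g a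

theorem pmfMean_bind {α β : Type*} [Fintype α] [Fintype β] (p : PMF α) (f : α → PMF β)
    (g : β → ℝ) : pmfMean (p.bind f) g = pmfMean p fun a => pmfMean (f a) g := by
  simp only [pmfMean, PMF.bind_apply, tsum_fintype]
  have h : ∀ b, (∑ a, p a * f a b).toReal = ∑ a, (p a).toReal * (f a b).toReal := by
    intro b
    rw [ENNReal.toReal_sum fun a _ => ENNReal.mul_ne_top (p.apply_ne_top a) ((f a).apply_ne_top b)]
    simp [ENNReal.toReal_mul]
  simp_rw [h, Finset.sum_mul, Finset.mul_sum]
  rw [Finset.sum_comm]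
  simp_rw [mul_assoc]

theorem pmfMean_pure {α : Type*} [Fintype α] (a : α) (g : α → ℝ) :
    pmfMean (PMF.pure a) g = g a := by
  classical
  rw [pmfMean, Finset.sum_eq_single a]
  · simp
  · intro b _ hb; simp [PMF.pure_apply, hb]
  · simp

theorem pmfMean_map {α β : Type*} [Fintype α] [Fintype β] (p : PMF α) (f : α → β)
    (g : β → ℝ) : pmfMean (p.map f) g = pmfMean p fun a => g (f a) := by
  rw [PMF.map, pmfMean_bind]
  simp only [Function.comp_apply, pmfMean_pure]

open scoped Classical in
/-- Add option `o` for request `j` to the allocation `y` if the capacities permit it. -/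
def tryAdd (I : PackingLP m n K) (y : Fin n → Option (Fin K)) (j : Fin n) (o : Option (Fin K)) :
    Fin n → Option (Fin K) :=
  if ∀ i, I.usage (toVector (Function.update y j o)) i ≤ I.capacity i
    then Function.update y j o else y

/-- The expectation of `g` after one step of the algorithm, as a function of the allocation before
the step. -/
def Solver.stepMean (sol : I.Solver) (S : Finset (Fin n)) (j : Fin n) :
    ((Fin n → Option (Fin K)) → ℝ) →ₗ[ℝ] ((Fin n → Option (Fin K)) → ℝ) :=
  ∑ o, (sol.round S j o).toReal • LinearMap.funLeft ℝ ℝ fun y => I.tryAdd y j o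

theorem Solver.stepMean_apply (sol : I.Solver) (S : Finset (Fin n)) (j : Fin n)
    (g : (Fin n → Option (Fin K)) → ℝ) (y : Fin n → Option (Fin K)) :
    sol.stepMean S j g y = (1 - ∑ k, sol.solution S j k) * g (I.tryAdd y j none) +
      ∑ k, sol.solution S j k * g (I.tryAdd y j (some k)) := by
  have h0 : (sol.round S j none).toReal = 1 - ∑ k, sol.solution S j k := by
    simp only [Solver.round, PMF.ofFintype_apply, Option.elim]
    exact ENNReal.toReal_ofReal (sub_nonneg.2 (sol.sum_solution_le_one S j))
  have h1 : ∀ k, (sol.round S j (some k)).toReal = sol.solution S j k := by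
    intro k
    simp only [Solver.round, PMF.ofFintype_apply, Option.elim]
    exact ENNReal.toReal_ofReal (sol.solution_nonneg S j k)
  simp [Solver.stepMean, Fintype.sum_option, LinearMap.funLeft_apply, h0, h1]

theorem Solver.pmfMean_step (sol : I.Solver) (S : Finset (Fin n)) (j : Fin n)
    (g : (Fin n → Option (Fin K)) → ℝ) (y : Fin n → Option (Fin K)) :
    pmfMean (sol.step S j y) g = sol.stepMean S j g y := by
  rw [Solver.step, pmfMean_map]
  simp [pmfMean, Solver.stepMean, LinearMap.funLeft_apply, tryAdd]

/-- The expectation of a function of the allocation after the requests of a set `S` of size `l` have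
arrived in uniformly random order. The recursion is over the last arrival, which is uniformly random
in `S`. -/
def Solver.orderMean (sol : I.Solver) :
    ℕ → Finset (Fin n) → ((Fin n → Option (Fin K)) → ℝ) →ₗ[ℝ] ℝ
  | 0, _ => LinearMap.proj fun _ => none
  | l + 1, S => ((l : ℝ) + 1)⁻¹ •
      ∑ j ∈ S, (sol.orderMean l (S.erase j)).comp (sol.stepMean S j)

theorem Solver.orderMean_zero (sol : I.Solver) (S : Finset (Fin n))
    (g : (Fin n → Option (Fin K)) → ℝ) : sol.orderMean 0 S g = g fun _ => none := by
  simp [Solver.orderMean]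

theorem Solver.orderMean_succ (sol : I.Solver) (l : ℕ) (S : Finset (Fin n))
    (g : (Fin n → Option (Fin K)) → ℝ) :
    sol.orderMean (l + 1) S g =
      ((l : ℝ) + 1)⁻¹ * ∑ j ∈ S, sol.orderMean l (S.erase j) (sol.stepMean S j g) := by
  simp [Solver.orderMean]

/-- Averaged over the arrival order, the law of the allocation after `l` steps is the one in which
the first `l` requests are reshuffled. The test function may depend on the arrival order, but not on
the order of the first `l` requests. -/
theorem Solver.sum_perm_run (sol : I.Solver) {l : ℕ} (hl : l ≤ n)
    (φ : Equiv.Perm (Fin n) → (Fin n → Option (Fin K)) → ℝ)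
    (hφ : ∀ π (s t : Fin n), (s : ℕ) < l → (t : ℕ) < l → φ (π * Equiv.swap s t) = φ π) :
    ∑ π, pmfMean (sol.run π l) (φ π) = ∑ π, sol.orderMean l (arrived π l) (φ π) := by
  induction l generalizing φ with
  | zero => simp [Solver.run, pmfMean_pure, Solver.orderMean_zero]
  | succ l ih =>
    have hln : l < n := hl
    have h1 : ∀ π, pmfMean (sol.run π (l + 1)) (φ π) = pmfMean (sol.run π l)
        (sol.stepMean (arrived π (l + 1)) (π ⟨l, hln⟩) (φ π)) := by
      intro π
      rw [Solver.run, dif_pos hln, pmfMean_bind]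
      simp_rw [Solver.pmfMean_step]
    simp_rw [h1, Solver.orderMean_succ]
    rw [ih hln.le, ← Finset.mul_sum, sum_perm_sum_arrived (hl := hln) fun π j =>
      sol.orderMean l ((arrived π (l + 1)).erase j) (sol.stepMean (arrived π (l + 1)) j (φ π))]
    · rw [← mul_assoc, inv_mul_cancel₀ (by positivity), one_mul]
      simp_rw [arrived_succ_erase _ hln]
    · intro π s hs
      rw [arrived_mul_swap π hs (by simp), hφ π _ _ hs (by simp)]
    · intro π s t hs ht
      have h2 : (π * Equiv.swap s t) ⟨l, hln⟩ = π ⟨l, hln⟩ := by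
        rw [Equiv.Perm.mul_apply, Equiv.swap_apply_of_ne_of_ne]
        · rintro rfl; simp at hs
        · rintro rfl; simp at ht
      rw [arrived_mul_swap π (by omega) (by omega), hφ π s t (by omega) (by omega), h2]

theorem Solver.expectedProfit_eq (sol : I.Solver) :
    sol.expectedProfit = sol.orderMean n Finset.univ fun y => I.value (toVector y) := by
  have h1 : sol.expectedProfit = pmfMean sol.output fun y => I.value (toVector y) := rfl
  have h2 := sol.sum_perm_run le_rfl (fun _ y => I.value (toVector y)) fun _ _ _ _ _ => rfl
  simp_rw [arrived_eq_univ] at h2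
  rw [h1, Solver.output, pmfMean_bind, pmfMean]
  simp only [PMF.uniformOfFintype_apply, ENNReal.toReal_inv, ENNReal.toReal_natCast]
  rw [← Finset.mul_sum, h2, Finset.sum_const, nsmul_eq_mul, Finset.card_univ, ← mul_assoc,
    inv_mul_cancel₀ (by positivity), one_mul]

/-! ### Invariants of the algorithm -/

/-- The allocations that can occur when exactly the requests in `S` have arrived: only those are
served, and all capacities are respected. -/
def Admissible (I : PackingLP m n K) (S : Finset (Fin n)) (y : Fin n → Option (Fin K)) : Prop :=
  (∀ j ∉ S, y j = none) ∧ ∀ i, I.usage (toVector y) i ≤ I.capacity i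

theorem admissible_none (S : Finset (Fin n)) : I.Admissible S fun _ => none :=
  ⟨fun _ _ => rfl, fun i => by simpa [usage, toVector] using I.capacity_nonneg i⟩

theorem Admissible.tryAdd {S : Finset (Fin n)} {j : Fin n} {y : Fin n → Option (Fin K)}
    (hj : j ∈ S) (hy : I.Admissible (S.erase j) y) (o : Option (Fin K)) :
    I.Admissible S (I.tryAdd y j o) := by
  unfold PackingLP.tryAdd
  split_ifs with h
  · refine ⟨fun j' hj' => ?_, h⟩
    have hne : j' ≠ j := fun e => hj' (e ▸ hj)
    rw [Function.update_of_ne hne]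
    exact hy.1 j' fun h' => hj' (Finset.mem_of_mem_erase h')
  · exact ⟨fun j' hj' => hy.1 j' fun h' => hj' (Finset.mem_of_mem_erase h'), hy.2⟩

theorem Admissible.eq_none {S : Finset (Fin n)} {j : Fin n} {y : Fin n → Option (Fin K)}
    (hy : I.Admissible (S.erase j) y) : y j = none := hy.1 j (by simp)

theorem tryAdd_none {j : Fin n} {y : Fin n → Option (Fin K)} (hj : y j = none) :
    I.tryAdd y j none = y := by
  have h : Function.update y j none = y := by rw [← hj, Function.update_eq_self]
  unfold tryAdd
  rw [h, ite_self]

theorem sum_mul_toVector_update (f : Fin n → Fin K → ℝ) {j : Fin n} {y : Fin n → Option (Fin K)}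
    (hj : y j = none) (k : Fin K) :
    ∑ j', ∑ k', f j' k' * toVector (Function.update y j (some k)) j' k' =
      ∑ j', ∑ k', f j' k' * toVector y j' k' + f j k := by
  rw [← Finset.add_sum_erase _ _ (Finset.mem_univ j),
    ← Finset.add_sum_erase Finset.univ (fun j' => ∑ k', f j' k' * toVector y j' k')
      (Finset.mem_univ j)]
  have h1 : ∀ j' ∈ Finset.univ.erase j,
      ∑ k', f j' k' * toVector (Function.update y j (some k)) j' k' =
        ∑ k', f j' k' * toVector y j' k' := by
    intro j' hj'
    simp [toVector, Function.update_of_ne (Finset.ne_of_mem_erase hj')]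
  rw [Finset.sum_congr rfl h1]
  simp [toVector, hj, add_comm]

theorem usage_update {j : Fin n} {y : Fin n → Option (Fin K)} (hj : y j = none) (k : Fin K)
    (i : Fin m) : I.usage (toVector (Function.update y j (some k))) i =
      I.usage (toVector y) i + I.demand i j k :=
  sum_mul_toVector_update _ hj k

theorem value_update {j : Fin n} {y : Fin n → Option (Fin K)} (hj : y j = none) (k : Fin K) :
    I.value (toVector (Function.update y j (some k))) = I.value (toVector y) + I.profit j k :=
  sum_mul_toVector_update _ hj k

theorem Solver.stepMean_mono (sol : I.Solver) {S : Finset (Fin n)} {j : Fin n} (hj : j ∈ S)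
    {g h : (Fin n → Option (Fin K)) → ℝ} (hgh : ∀ y, I.Admissible S y → g y ≤ h y)
    {y : Fin n → Option (Fin K)} (hy : I.Admissible (S.erase j) y) :
    sol.stepMean S j g y ≤ sol.stepMean S j h y := by
  rw [Solver.stepMean_apply, Solver.stepMean_apply]
  refine add_le_add (mul_le_mul_of_nonneg_left (hgh _ (hy.tryAdd hj _))
    (sub_nonneg.2 (sol.sum_solution_le_one S j))) (Finset.sum_le_sum fun k _ =>
    mul_le_mul_of_nonneg_left (hgh _ (hy.tryAdd hj _)) (sol.solution_nonneg S j k))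

theorem Solver.orderMean_mono (sol : I.Solver) {l : ℕ} {S : Finset (Fin n)}
    {g h : (Fin n → Option (Fin K)) → ℝ} (hgh : ∀ y, I.Admissible S y → g y ≤ h y) :
    sol.orderMean l S g ≤ sol.orderMean l S h := by
  induction l generalizing S g h with
  | zero => simpa [Solver.orderMean_zero] using hgh _ (admissible_none S)
  | succ l ih =>
    rw [Solver.orderMean_succ, Solver.orderMean_succ]
    refine mul_le_mul_of_nonneg_left (Finset.sum_le_sum fun j hj => ?_) (by positivity)
    exact ih fun y hy => sol.stepMean_mono hj hgh hy

theorem Solver.orderMean_const (sol : I.Solver) {l : ℕ} {S : Finset (Fin n)} (hS : S.card = l)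
    (c : ℝ) : sol.orderMean l S (fun _ => c) = c := by
  induction l generalizing S with
  | zero => simp [Solver.orderMean_zero]
  | succ l ih =>
    have h1 : ∀ j, sol.stepMean S j (fun _ => c) = fun _ => c := by
      intro j; funext y
      rw [Solver.stepMean_apply, ← Finset.sum_mul]; ring
    rw [Solver.orderMean_succ, Finset.sum_congr rfl fun j hj => by
      rw [h1, ih (by rw [Finset.card_erase_of_mem hj, hS]; rfl)]]
    rw [Finset.sum_const, hS, nsmul_eq_mul, ← mul_assoc]
    push_cast
    rw [inv_mul_cancel₀ (by positivity), one_mul]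

theorem Solver.admissible_of_mem_support_run (sol : I.Solver) (π : Equiv.Perm (Fin n)) {l : ℕ}
    (hl : l ≤ n) {y : Fin n → Option (Fin K)} (hy : y ∈ (sol.run π l).support) :
    I.Admissible (arrived π l) y := by
  induction l generalizing y with
  | zero =>
    rw [Solver.run, PMF.support_pure, Set.mem_singleton_iff] at hy
    exact hy ▸ admissible_none _
  | succ l ih =>
    rw [Solver.run, dif_pos (show l < n from hl), PMF.mem_support_bind_iff] at hy
    obtain ⟨y', hy', h⟩ := hy
    rw [Solver.step, PMF.mem_support_map_iff] at h
    obtain ⟨o, -, rfl⟩ := h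
    have h1 := ih (by omega) hy'
    rw [← arrived_succ_erase π hl] at h1
    exact h1.tryAdd (by simp [mem_arrived]) o

theorem Solver.feasible_of_mem_support_output (sol : I.Solver) {y : Fin n → Option (Fin K)}
    (hy : y ∈ sol.output.support) : toVector y ∈ I.feasible 1 Finset.univ := by
  rw [Solver.output, PMF.mem_support_bind_iff] at hy
  obtain ⟨π, -, hπ⟩ := hy
  refine ⟨fun i => ?_, fun j k => ?_, fun j _ => ?_, by simp⟩
  · rw [one_mul]; exact (sol.admissible_of_mem_support_run π le_rfl hπ).2 i
  · unfold toVector; split_ifs <;> norm_num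
  · cases h : y j with
    | none => simp [toVector, h]
    | some k => simp [toVector, h]

/-! ### Concentration of the consumed capacity -/

theorem demand_le_maxDemand (I : PackingLP m n K) (i : Fin m) (j : Fin n) (k : Fin K) :
    I.demand i j k ≤ I.maxDemand i :=
  le_ciSup (f := fun p : Fin n × Fin K => I.demand i p.1 p.2) (Set.finite_range _).bddAbove (j, k)

theorem maxDemand_pos {i : Fin m} {j : Fin n} {k : Fin K} (h : I.demand i j k ≠ 0) :
    0 < I.maxDemand i :=
  ((I.demand_nonneg i j k).lt_of_ne h.symm).trans_le (I.demand_le_maxDemand i j k)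

theorem le_capacity_div_maxDemand {B : ℝ} (hB : (B : EReal) ≤ I.capacityRatio) {i : Fin m}
    (hi : 0 < I.maxDemand i) : B ≤ I.capacity i / I.maxDemand i :=
  EReal.coe_le_coe_iff.1 (hB.trans (iInf₂_le i hi))

theorem Solver.sum_demand_solution_le (sol : I.Solver) (S : Finset (Fin n)) (i : Fin m) :
    ∑ j ∈ S, ∑ k, sol.solution S j k * I.demand i j k ≤ S.card / n * I.capacity i := by
  refine le_trans ?_ ((sol.isOptimal S).1.1 i)
  unfold usage
  simp_rw [mul_comm (sol.solution S _ _)]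
  exact Finset.sum_le_sum_of_subset_of_nonneg (Finset.subset_univ S) fun j _ _ =>
    Finset.sum_nonneg fun k _ => mul_nonneg (I.demand_nonneg _ _ _) (sol.solution_nonneg _ _ _)

theorem Solver.stepMean_exp_usage_le (sol : I.Solver) {S : Finset (Fin n)} {j : Fin n} {i : Fin m}
    (hi : 0 < I.maxDemand i) {lam : ℝ} (hlam : 0 ≤ lam) {y : Fin n → Option (Fin K)}
    (hy : I.Admissible (S.erase j) y) :
    sol.stepMean S j (fun y => Real.exp (lam * (I.usage (toVector y) i / I.maxDemand i))) y ≤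
      (1 + (Real.exp lam - 1) *
        ((∑ k, sol.solution S j k * I.demand i j k) / I.maxDemand i)) *
      Real.exp (lam * (I.usage (toVector y) i / I.maxDemand i)) := by
  set g : (Fin n → Option (Fin K)) → ℝ :=
    fun y => Real.exp (lam * (I.usage (toVector y) i / I.maxDemand i)) with hg
  have hjy := hy.eq_none
  have he : 0 ≤ Real.exp lam - 1 := by linarith [Real.add_one_le_exp lam]
  have h1 : ∀ k, g (I.tryAdd y j (some k)) ≤
      (1 + (Real.exp lam - 1) * (I.demand i j k / I.maxDemand i)) * g y := by
    intro k
    have h0 : 0 ≤ I.demand i j k / I.maxDemand i := div_nonneg (I.demand_nonneg _ _ _) hi.le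
    unfold tryAdd
    split_ifs
    · simp only [hg]
      rw [usage_update hjy, add_div, mul_add, Real.exp_add, mul_comm]
      refine mul_le_mul_of_nonneg_right ?_ (Real.exp_pos _).le
      exact exp_mul_le_of_mem_Icc h0 ((div_le_one hi).2 (I.demand_le_maxDemand i j k)) lam
    · refine le_mul_of_one_le_left (Real.exp_pos _).le ?_
      have := mul_nonneg he h0
      linarith
  rw [Solver.stepMean_apply, tryAdd_none hjy]
  have h2 := Finset.sum_le_sum fun k (_ : k ∈ Finset.univ) =>
    mul_le_mul_of_nonneg_left (h1 k) (sol.solution_nonneg S j k)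
  have h3 : ∑ k, sol.solution S j k *
      ((1 + (Real.exp lam - 1) * (I.demand i j k / I.maxDemand i)) * g y) =
      (∑ k, sol.solution S j k) * g y + (Real.exp lam - 1) *
        ((∑ k, sol.solution S j k * I.demand i j k) / I.maxDemand i) * g y := by
    rw [Finset.sum_mul, Finset.sum_div, Finset.mul_sum, Finset.sum_mul, ← Finset.sum_add_distrib]
    exact Finset.sum_congr rfl fun k _ => by ring
  rw [h3] at h2
  change _ ≤ _ * g y
  linarith

/-- The consumption of a resource by the requests of a set of size `l`, arriving in random order,
has the exponential moments of a sum of independent variables with mean at most `l / n` times the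
capacity: at each step, given the set of known requests, the current request is uniform in this set,
and so consumes in expectation at most `1 / n` of the capacity. -/
theorem Solver.orderMean_exp_usage_le (sol : I.Solver) {i : Fin m} (hi : 0 < I.maxDemand i)
    {lam : ℝ} (hlam : 0 ≤ lam) {l : ℕ} {S : Finset (Fin n)} (hS : S.card = l) :
    sol.orderMean l S (fun y => Real.exp (lam * (I.usage (toVector y) i / I.maxDemand i))) ≤
      Real.exp ((Real.exp lam - 1) * (I.capacity i / I.maxDemand i) / n) ^ l := by
  set g : (Fin n → Option (Fin K)) → ℝ :=
    fun y => Real.exp (lam * (I.usage (toVector y) i / I.maxDemand i)) with hg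
  have he : 0 ≤ Real.exp lam - 1 := by linarith [Real.add_one_le_exp lam]
  set c : ℝ := Real.exp ((Real.exp lam - 1) * (I.capacity i / I.maxDemand i) / n) with hc
  induction l generalizing S with
  | zero => simp [Solver.orderMean_zero, hg, usage, toVector]
  | succ l ih =>
    have h1 : ∀ j ∈ S, sol.orderMean l (S.erase j) (sol.stepMean S j g) ≤
        (1 + (Real.exp lam - 1) *
          ((∑ k, sol.solution S j k * I.demand i j k) / I.maxDemand i)) * c ^ l := by
      intro j hj
      have hnn : 0 ≤ (∑ k, sol.solution S j k * I.demand i j k) / I.maxDemand i :=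
        div_nonneg (Finset.sum_nonneg fun k _ =>
          mul_nonneg (sol.solution_nonneg _ _ _) (I.demand_nonneg _ _ _)) hi.le
      refine (sol.orderMean_mono (h := (1 + (Real.exp lam - 1) *
          ((∑ k, sol.solution S j k * I.demand i j k) / I.maxDemand i)) • g)
          fun y hy => sol.stepMean_exp_usage_le hi hlam hy).trans ?_
      rw [map_smul, smul_eq_mul]
      refine mul_le_mul_of_nonneg_left
        (ih (by rw [Finset.card_erase_of_mem hj, hS]; rfl)) ?_
      have := mul_nonneg he hnn
      linarith
    rw [Solver.orderMean_succ, inv_mul_le_iff₀ (by positivity)]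
    refine (Finset.sum_le_sum h1).trans ?_
    rw [← Finset.sum_mul, pow_succ, Finset.sum_add_distrib, ← Finset.mul_sum, ← Finset.sum_div,
      Finset.sum_const, hS, nsmul_eq_mul, mul_one, mul_comm (c ^ l), ← mul_assoc]
    refine mul_le_mul_of_nonneg_right ?_ (pow_nonneg (Real.exp_pos _).le _)
    have h2 := sol.sum_demand_solution_le S i
    rw [hS] at h2
    have h3 : (Real.exp lam - 1) *
        ((∑ j ∈ S, ∑ k, sol.solution S j k * I.demand i j k) / I.maxDemand i) ≤
        (Real.exp lam - 1) * (((l + 1 : ℕ) : ℝ) / n * I.capacity i / I.maxDemand i) :=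
      mul_le_mul_of_nonneg_left (div_le_div_of_nonneg_right h2 hi.le) he
    have h4 : (l + 1 : ℝ) * ((Real.exp lam - 1) * (I.capacity i / I.maxDemand i) / n + 1) ≤
        (l + 1) * c :=
      mul_le_mul_of_nonneg_left (Real.add_one_le_exp _) (by positivity)
    refine le_trans (le_trans (add_le_add le_rfl h3) (le_of_eq ?_)) h4
    push_cast
    ring

open scoped Classical in
/-- The indicator of the event that option `k` for request `j` does not fit into the remaining
capacities. -/
def rejection (I : PackingLP m n K) (j : Fin n) (k : Fin K) (y : Fin n → Option (Fin K)) : ℝ :=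
  if ∀ i, I.usage (toVector (Function.update y j (some k))) i ≤ I.capacity i then 0 else 1

theorem rejection_le_one (j : Fin n) (k : Fin K) (y : Fin n → Option (Fin K)) :
    I.rejection j k y ≤ 1 := by
  unfold rejection; split_ifs <;> norm_num

/-- Only the resources that the option needs can cause its rejection. -/
theorem rejection_le_sum {S : Finset (Fin n)} {j : Fin n} (k : Fin K) {y : Fin n → Option (Fin K)}
    (hy : I.Admissible (S.erase j) y) {lam : ℝ} (hlam : 0 ≤ lam) :
    I.rejection j k y ≤ ∑ i with I.demand i j k ≠ 0,
      Real.exp (-(lam * (I.capacity i / I.maxDemand i - 1))) *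
        Real.exp (lam * (I.usage (toVector y) i / I.maxDemand i)) := by
  unfold rejection
  split_ifs with h
  · positivity
  · push Not at h
    obtain ⟨i, hi⟩ := h
    rw [usage_update hy.eq_none] at hi
    have hne : I.demand i j k ≠ 0 := by
      intro h0
      have := hy.2 i
      linarith
    have hM := maxDemand_pos hne
    refine le_trans ?_ (Finset.single_le_sum (fun i _ => by positivity)
      (Finset.mem_filter.2 ⟨Finset.mem_univ i, hne⟩))
    rw [← Real.exp_add, Real.one_le_exp_iff]
    have h1 : I.capacity i / I.maxDemand i ≤ I.usage (toVector y) i / I.maxDemand i + 1 := by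
      rw [div_add_one hM.ne']
      exact div_le_div_of_nonneg_right (by linarith [I.demand_le_maxDemand i j k]) hM.le
    nlinarith [mul_le_mul_of_nonneg_left h1 hlam]

/-- A bound on the probability that the option chosen at (zero-based) position `l` is rejected. -/
def rejectionBound (n d : ℕ) (B : ℝ) (l : ℕ) : ℝ :=
  min 1 (3 * d * Real.exp (-((1 - l / n : ℝ) ^ 2 * B / 4)))

theorem Solver.orderMean_rejection_le (sol : I.Solver) {d : ℕ} {B : ℝ} (hd : I.ColumnSparse d)
    (hB : (B : EReal) ≤ I.capacityRatio) {l : ℕ} (hl : l < n) {S : Finset (Fin n)} {j : Fin n}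
    (hS : (S.erase j).card = l) (k : Fin K) :
    sol.orderMean l (S.erase j) (I.rejection j k) ≤ rejectionBound n d B l := by
  refine le_min ?_ ?_
  · exact (sol.orderMean_mono fun y _ => rejection_le_one j k y).trans_eq (sol.orderMean_const hS 1)
  have hn : (0 : ℝ) < n := by exact_mod_cast (show 0 < n by omega)
  -- Markov's inequality is applied with the exponent `τ / 2`, which minimizes
  -- `lam ^ 2 * β - lam * τ * β`.
  set τ : ℝ := 1 - l / n with hτ
  have hτ0 : 0 ≤ τ := by
    rw [hτ, sub_nonneg, div_le_one hn]; exact_mod_cast hl.le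
  have hτ1 : τ ≤ 1 := by
    rw [hτ]; linarith [div_nonneg (Nat.cast_nonneg (α := ℝ) l) hn.le]
  have h1 := sol.orderMean_mono (l := l)
    (h := ∑ i with I.demand i j k ≠ 0,
      Real.exp (-(τ / 2 * (I.capacity i / I.maxDemand i - 1))) •
        fun y => Real.exp (τ / 2 * (I.usage (toVector y) i / I.maxDemand i)))
    fun y (hy : I.Admissible (S.erase j) y) =>
      (rejection_le_sum k hy (lam := τ / 2) (by linarith)).trans_eq (by simp [Finset.sum_apply])
  refine h1.trans ?_
  rw [map_sum]
  have h2 : ∀ i ∈ Finset.univ.filter fun i => I.demand i j k ≠ 0,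
      sol.orderMean l (S.erase j) (Real.exp (-(τ / 2 * (I.capacity i / I.maxDemand i - 1))) •
        fun y => Real.exp (τ / 2 * (I.usage (toVector y) i / I.maxDemand i))) ≤
      3 * Real.exp (-(τ ^ 2 * B / 4)) := by
    intro i hi
    have hM := maxDemand_pos (Finset.mem_filter.1 hi).2
    have hβ := le_capacity_div_maxDemand hB hM
    have hβ0 : 0 ≤ I.capacity i / I.maxDemand i := div_nonneg (I.capacity_nonneg i) hM.le
    rw [map_smul, smul_eq_mul]
    refine (mul_le_mul_of_nonneg_left (sol.orderMean_exp_usage_le hM (by linarith) hS)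
      (Real.exp_pos _).le).trans ?_
    set β := I.capacity i / I.maxDemand i
    have h3 : Real.exp (1 / 2) ≤ 3 :=
      (Real.exp_le_exp.2 (by norm_num)).trans (Real.exp_one_lt_d9.le.trans (by norm_num))
    refine le_trans ?_ (mul_le_mul_of_nonneg_right h3 (Real.exp_pos _).le)
    rw [← Real.exp_nat_mul, ← Real.exp_add, ← Real.exp_add, Real.exp_le_exp]
    have h4 := (abs_le.1 (Real.abs_exp_sub_one_sub_id_le (x := τ / 2)
      (by rw [abs_of_nonneg (by linarith)]; linarith))).2
    have h5 : (l : ℝ) * ((Real.exp (τ / 2) - 1) * β / n) = (1 - τ) * β * (Real.exp (τ / 2) - 1) := by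
      rw [hτ]; field_simp; ring
    rw [h5]
    have h6 : (1 - τ) * β * (Real.exp (τ / 2) - 1) ≤ (1 - τ) * β * (τ / 2 + (τ / 2) ^ 2) :=
      mul_le_mul_of_nonneg_left (by linarith) (mul_nonneg (by linarith) hβ0)
    have h7 : τ ^ 2 * B ≤ τ ^ 2 * β := mul_le_mul_of_nonneg_left hβ (sq_nonneg _)
    have h8 : 0 ≤ τ * (β * (τ / 2) ^ 2) := by positivity
    nlinarith
  refine (Finset.sum_le_card_nsmul _ _ _ h2).trans ?_
  rw [nsmul_eq_mul]
  have h3 : ((Finset.univ.filter fun i => I.demand i j k ≠ 0).card : ℝ) ≤ d := by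
    exact_mod_cast hd j k
  calc _ ≤ (d : ℝ) * (3 * Real.exp (-(τ ^ 2 * B / 4))) :=
        mul_le_mul_of_nonneg_right h3 (by positivity)
    _ = _ := by ring

/-! ### The expected profit of one step -/

theorem Solver.stepMean_value (sol : I.Solver) {S : Finset (Fin n)} {j : Fin n}
    {y : Fin n → Option (Fin K)} (hy : I.Admissible (S.erase j) y) :
    sol.stepMean S j (fun y => I.value (toVector y)) y = I.value (toVector y) +
      ∑ k, I.profit j k * sol.solution S j k * (1 - I.rejection j k y) := by
  have hjy := hy.eq_none
  have h1 : ∀ k, I.value (toVector (I.tryAdd y j (some k))) =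
      I.value (toVector y) + I.profit j k * (1 - I.rejection j k y) := by
    intro k
    unfold tryAdd rejection
    split_ifs
    · rw [value_update hjy]; ring
    · ring
  rw [Solver.stepMean_apply, tryAdd_none hjy]
  simp_rw [h1, mul_add, Finset.sum_add_distrib, ← Finset.sum_mul]
  rw [← add_assoc, ← add_mul, sub_add_cancel, one_mul]
  congr 1
  exact Finset.sum_congr rfl fun k _ => by ring

/-- One more arrival adds in expectation the average share `I.value (sol.solution S) / (l + 1)` of a
request in the current fractional optimum, up to rejections. The rejection bound applies to each
choice of the last request, since the requests before it are still in random order. -/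
theorem Solver.le_orderMean_succ_value (sol : I.Solver) {d : ℕ} {B : ℝ} (hd : I.ColumnSparse d)
    (hB : (B : EReal) ≤ I.capacityRatio) {l : ℕ} (hl : l < n) {S : Finset (Fin n)}
    (hS : S.card = l + 1) :
    ((l : ℝ) + 1)⁻¹ * (∑ j ∈ S, sol.orderMean l (S.erase j) fun y => I.value (toVector y)) +
      ((l : ℝ) + 1)⁻¹ * ((1 - rejectionBound n d B l) * I.value (sol.solution S)) ≤
      sol.orderMean (l + 1) S fun y => I.value (toVector y) := by
  rw [Solver.orderMean_succ, ← mul_add]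
  refine mul_le_mul_of_nonneg_left ?_ (by positivity)
  have hval : I.value (sol.solution S) = ∑ j ∈ S, ∑ k, I.profit j k * sol.solution S j k := by
    refine (Finset.sum_subset (Finset.subset_univ S) fun j _ hj => ?_).symm
    simp [(sol.isOptimal S).1.2.2.2 j hj]
  rw [hval, Finset.mul_sum, ← Finset.sum_add_distrib]
  refine Finset.sum_le_sum fun j hj => ?_
  have hc : (S.erase j).card = l := by rw [Finset.card_erase_of_mem hj, hS]; rfl
  have h1 := sol.orderMean_mono (l := l) (S := S.erase j)
    (g := (fun y => I.value (toVector y)) + ∑ k, (I.profit j k * sol.solution S j k) •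
      ((fun _ => 1) - I.rejection j k)) (h := sol.stepMean S j fun y => I.value (toVector y))
    fun y hy => by rw [sol.stepMean_value hy]; simp [Finset.sum_apply]
  refine le_trans ?_ h1
  rw [map_add, map_sum]
  refine add_le_add le_rfl ?_
  rw [Finset.mul_sum]
  refine Finset.sum_le_sum fun k _ => ?_
  rw [map_smul, map_sub, sol.orderMean_const hc, smul_eq_mul, mul_comm]
  refine mul_le_mul_of_nonneg_left ?_ (mul_nonneg (I.profit_nonneg j k) (sol.solution_nonneg _ _ _))
  linarith [sol.orderMean_rejection_le hd hB hl hc k]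

theorem Solver.le_sum_perm_orderMean_succ_value (sol : I.Solver) {d : ℕ} {B : ℝ}
    (hd : I.ColumnSparse d) (hB : (B : EReal) ≤ I.capacityRatio) {l : ℕ} (hl : l < n) :
    ∑ π, sol.orderMean l (arrived π l) (fun y => I.value (toVector y)) +
      (1 - rejectionBound n d B l) *
        (((l : ℝ) + 1)⁻¹ * ∑ π, I.value (sol.solution (arrived π (l + 1)))) ≤
      ∑ π, sol.orderMean (l + 1) (arrived π (l + 1)) fun y => I.value (toVector y) := by
  have h1 := Finset.sum_le_sum fun π (_ : π ∈ Finset.univ) =>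
    sol.le_orderMean_succ_value hd hB hl (card_arrived π hl)
  refine le_trans (le_of_eq ?_) h1
  rw [Finset.sum_add_distrib, ← Finset.mul_sum, sum_perm_sum_arrived (hl := hl) fun π j =>
      sol.orderMean l ((arrived π (l + 1)).erase j) fun y => I.value (toVector y)]
  · simp_rw [arrived_succ_erase _ hl]
    rw [inv_mul_cancel_left₀ (by positivity), ← Finset.mul_sum, ← Finset.mul_sum]
    ring
  · intro π s hs
    rw [arrived_mul_swap π hs (by simp)]

/-! ### The optimum of a random sample -/

/-- The consumption of resource `i` by the requests of `S` in the fractional solution `x`, relative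
to the scaled capacity. -/
def load (I : PackingLP m n K) (x : Fin n → Fin K → ℝ) (f : ℝ) (S : Finset (Fin n)) (i : Fin m) :
    ℝ := (∑ j ∈ S, ∑ k, I.demand i j k * x j k) / (f * I.capacity i)

/-- An upper bound for the excess over `1` of the largest load among the resources that option `k` for
request `j` needs. The maximum is replaced by a sum of exponentials with rate `lam`, offset by `γ`, so
that its expectation can be bounded by exponential moments. -/
def excess (I : PackingLP m n K) (x : Fin n → Fin K → ℝ) (f γ lam : ℝ) (S : Finset (Fin n))
    (j : Fin n) (k : Fin K) : ℝ :=
  γ + ∑ i with I.demand i j k ≠ 0, Real.exp (lam * (I.load x f S i - 1 - γ)) / lam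

theorem excess_nonneg (I : PackingLP m n K) (x : Fin n → Fin K → ℝ) (f : ℝ) {γ lam : ℝ}
    (hγ : 0 ≤ γ) (hlam : 0 < lam) (S : Finset (Fin n)) (j : Fin n) (k : Fin K) :
    0 ≤ I.excess x f γ lam S j k := by
  unfold excess; positivity

theorem load_sub_one_le_excess (x : Fin n → Fin K → ℝ) (f : ℝ) (γ : ℝ) {lam : ℝ} (hlam : 0 < lam)
    (S : Finset (Fin n)) {i : Fin m} {j : Fin n} {k : Fin K} (h : I.demand i j k ≠ 0) :
    I.load x f S i - 1 ≤ I.excess x f γ lam S j k := by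
  have h1 : I.load x f S i - 1 - γ ≤ Real.exp (lam * (I.load x f S i - 1 - γ)) / lam := by
    rw [le_div_iff₀ hlam, mul_comm]
    linarith [Real.add_one_le_exp (lam * (I.load x f S i - 1 - γ))]
  have h2 := Finset.single_le_sum
    (f := fun i => Real.exp (lam * (I.load x f S i - 1 - γ)) / lam)
    (s := Finset.univ.filter fun i => I.demand i j k ≠ 0)
    (fun i _ => by positivity) (Finset.mem_filter.2 ⟨Finset.mem_univ i, h⟩)
  unfold excess
  linarith

theorem Solver.value_solution_nonneg (sol : I.Solver) (S : Finset (Fin n)) :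
    0 ≤ I.value (sol.solution S) :=
  Finset.sum_nonneg fun j _ => Finset.sum_nonneg fun k _ =>
    mul_nonneg (I.profit_nonneg j k) (sol.solution_nonneg S j k)

/-- Scaling down each option of `x` according to the most overloaded resource that it needs gives a
feasible solution of the LP for the sample `S`. -/
theorem Solver.le_value_solution (sol : I.Solver) {x : Fin n → Fin K → ℝ}
    (hx : x ∈ I.feasible 1 Finset.univ) {γ lam : ℝ} (hγ : 0 ≤ γ) (hlam : 0 < lam)
    (S : Finset (Fin n)) :
    ∑ j ∈ S, ∑ k, I.profit j k * x j k * (1 - I.excess x (S.card / n) γ lam S j k) ≤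
      I.value (sol.solution S) := by
  obtain ⟨hcap, hx0, hx1, -⟩ := hx
  set f : ℝ := S.card / n with hf
  have hf0 : 0 ≤ f := by positivity
  set θ : Fin n → Fin K → ℝ := fun j k => max 0 (1 - I.excess x f γ lam S j k) with hθ
  have hθ0 : ∀ j k, 0 ≤ θ j k := fun j k => le_max_left _ _
  have hθ1 : ∀ j k, θ j k ≤ 1 := fun j k =>
    max_le zero_le_one (by linarith [I.excess_nonneg x f hγ hlam S j k])
  set z : Fin n → Fin K → ℝ := fun j k => if j ∈ S then x j k * θ j k else 0 with hz
  have hzfeas : z ∈ I.feasible f S := by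
    refine ⟨fun i => ?_, fun j k => ?_, fun j hj => ?_, fun j hj k => by simp [hz, hj]⟩
    · have hU : I.usage z i = ∑ j ∈ S, ∑ k, I.demand i j k * x j k * θ j k := by
        unfold usage
        rw [← Finset.sum_subset (Finset.subset_univ S) fun j _ hj => by simp [hz, hj]]
        refine Finset.sum_congr rfl fun j hj => Finset.sum_congr rfl fun k _ => ?_
        simp only [hz, if_pos hj]; ring
      have hax : ∀ j k, 0 ≤ I.demand i j k * x j k := fun j k =>
        mul_nonneg (I.demand_nonneg i j k) (hx0 j k)
      have hUS0 : 0 ≤ ∑ j ∈ S, ∑ k, I.demand i j k * x j k :=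
        Finset.sum_nonneg fun j _ => Finset.sum_nonneg fun k _ => hax j k
      have hUS : ∑ j ∈ S, ∑ k, I.demand i j k * x j k ≤ I.capacity i := by
        refine le_trans ?_ ((hcap i).trans_eq (one_mul _))
        exact Finset.sum_le_sum_of_subset_of_nonneg (Finset.subset_univ S) fun j _ _ =>
          Finset.sum_nonneg fun k _ => hax j k
      rw [hU]
      rcases (mul_nonneg hf0 (I.capacity_nonneg i)).eq_or_lt with h0 | h0
      · -- Either `S` is empty or resource `i` has capacity zero; then `x` does not use it.
        rw [← h0]
        have hle : ∑ j ∈ S, ∑ k, I.demand i j k * x j k * θ j k ≤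
            ∑ j ∈ S, ∑ k, I.demand i j k * x j k := Finset.sum_le_sum fun j _ =>
          Finset.sum_le_sum fun k _ => mul_le_of_le_one_right (hax j k) (hθ1 j k)
        rcases mul_eq_zero.1 h0.symm with h | h
        · rcases div_eq_zero_iff.1 h with h | h
          · rw [Nat.cast_eq_zero, Finset.card_eq_zero] at h
            simp [h]
          · rw [Nat.cast_eq_zero] at h
            subst h
            simp [Finset.eq_empty_of_isEmpty]
        · linarith
      · have hle : ∀ j k, I.demand i j k * x j k * θ j k ≤
            I.demand i j k * x j k * max 0 (2 - I.load x f S i) := by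
          intro j k
          by_cases ha : I.demand i j k = 0
          · simp [ha]
          · refine mul_le_mul_of_nonneg_left (max_le_max le_rfl ?_) (hax j k)
            linarith [load_sub_one_le_excess x f γ hlam S ha]
        refine (Finset.sum_le_sum fun j _ => Finset.sum_le_sum fun k _ => hle j k).trans ?_
        simp_rw [← Finset.sum_mul]
        have hr : ∑ j ∈ S, ∑ k, I.demand i j k * x j k = I.load x f S i * (f * I.capacity i) := by
          rw [load, div_mul_cancel₀ _ h0.ne']
        have hr0 : 0 ≤ I.load x f S i := div_nonneg hUS0 h0.le
        rw [hr, mul_right_comm]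
        refine mul_le_of_le_one_left h0.le ?_
        rcases max_cases 0 (2 - I.load x f S i) with ⟨h, -⟩ | ⟨h, -⟩
        · rw [h]; simp
        · rw [h]; nlinarith [sq_nonneg (I.load x f S i - 1)]
    · simp only [hz]
      split_ifs
      · exact mul_nonneg (hx0 j k) (hθ0 j k)
      · rfl
    · simp only [hz, if_pos hj]
      exact (Finset.sum_le_sum fun k _ => mul_le_of_le_one_right (hx0 j k) (hθ1 j k)).trans
        (hx1 j (Finset.mem_univ j))
  refine le_trans ?_ ((sol.isOptimal S).2 z hzfeas)
  unfold value
  rw [← Finset.sum_subset (Finset.subset_univ S) fun j _ hj => by simp [hz, hj]]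
  refine Finset.sum_le_sum fun j hj => Finset.sum_le_sum fun k _ => ?_
  simp only [hz, if_pos hj]
  rw [← mul_assoc]
  exact mul_le_mul_of_nonneg_left (le_max_right _ _) (mul_nonneg (I.profit_nonneg j k) (hx0 j k))

/-- The exponential moment of the overload of resource `i` in the sample of the first `l + 1`
requests, weighted by a function `h` of the last of these. The last request itself contributes only
a bounded factor. The exponent and the slack `3 * √(L / B')`, with `B' = B * (l + 1) / n`, are such
that the bound `exp (-L)` pays for a sum over `exp L` resources. -/
theorem sum_perm_exp_load_le {x : Fin n → Fin K → ℝ} (hx : x ∈ I.feasible 1 Finset.univ) {B L : ℝ}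
    (hB0 : 0 < B) (hB : (B : EReal) ≤ I.capacityRatio) (hL : 1 ≤ L) {l : ℕ} (hl : l < n)
    (hLB : L ≤ B * ((l + 1) / n)) {i : Fin m} (hi : 0 < I.maxDemand i) {h : Fin n → ℝ}
    (hh : ∀ j, 0 ≤ h j) :
    ∑ π : Equiv.Perm (Fin n), h (π ⟨l, hl⟩) * Real.exp (√(L * (B * ((l + 1) / n))) *
        (I.load x ((l + 1) / n) (arrived π (l + 1)) i - 1 - 3 * √(L / (B * ((l + 1) / n))))) ≤
      Real.exp (-L) * ∑ π : Equiv.Perm (Fin n), h (π ⟨l, hl⟩) := by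
  obtain ⟨hcap, hx0, hx1, -⟩ := hx
  have hn : (0 : ℝ) < n := by exact_mod_cast (show 0 < n by omega)
  set f : ℝ := (l + 1) / n with hf
  have hf0 : 0 < f := by positivity
  set B' : ℝ := B * f with hB'
  have hB'0 : 0 < B' := by positivity
  set ε : ℝ := √(L / B') with hε
  set lam : ℝ := √(L * B') with hlam
  have hε0 : 0 ≤ ε := Real.sqrt_nonneg _
  have hε1 : ε ≤ 1 := Real.sqrt_le_one.2 ((div_le_one hB'0).2 hLB)
  have hlamε : lam = ε * B' := by
    rw [hlam, hε, show L * B' = L / B' * B' ^ 2 by field_simp, Real.sqrt_mul (by positivity),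
      Real.sqrt_sq hB'0.le]
  have hεsq : ε ^ 2 * B' = L := by
    rw [hε, Real.sq_sqrt (by positivity)]; field_simp
  set M := I.maxDemand i
  set β : ℝ := I.capacity i / M with hβ
  have hβB : B ≤ β := le_capacity_div_maxDemand hB hi
  have hβ0 : 0 < β := hB0.trans_le hβB
  have hcapβ : I.capacity i = β * M := by rw [hβ, div_mul_cancel₀ _ hi.ne']
  set u : Fin n → ℝ := fun j => (∑ k, I.demand i j k * x j k) / M with hu
  have hu0 : ∀ j, 0 ≤ u j := fun j => div_nonneg (Finset.sum_nonneg fun k _ =>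
    mul_nonneg (I.demand_nonneg i j k) (hx0 j k)) hi.le
  have hu1 : ∀ j, u j ≤ 1 := by
    intro j
    rw [hu]
    refine (div_le_one hi).2 ?_
    calc ∑ k, I.demand i j k * x j k ≤ ∑ k, M * x j k := Finset.sum_le_sum fun k _ =>
          mul_le_mul_of_nonneg_right (I.demand_le_maxDemand i j k) (hx0 j k)
      _ = M * ∑ k, x j k := by rw [Finset.mul_sum]
      _ ≤ M := mul_le_of_le_one_right hi.le (hx1 j (Finset.mem_univ j))
  have huβ : ∑ j, u j ≤ β := by
    rw [hu, ← Finset.sum_div, hβ]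
    exact div_le_div_of_nonneg_right ((hcap i).trans_eq (one_mul _)) hi.le
  set μ : ℝ := lam / (f * β) with hμ
  have hμ0 : 0 ≤ μ := div_nonneg (Real.sqrt_nonneg _) (by positivity)
  have hμε : μ ≤ ε := by
    rw [hμ, hlamε, div_le_iff₀ (by positivity), hB', mul_comm B f]
    exact mul_le_mul_of_nonneg_left (mul_le_mul_of_nonneg_left hβB hf0.le) hε0
  have hμlam : f * β * μ = lam := by rw [hμ, mul_div_cancel₀ _ (by positivity)]
  have hload : ∀ π : Equiv.Perm (Fin n), lam * I.load x f (arrived π (l + 1)) i =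
      μ * (u (π ⟨l, hl⟩) + ∑ t ∈ positions n l, u (π t)) := by
    intro π
    have h1 : u (π ⟨l, hl⟩) + ∑ t ∈ positions n l, u (π t) = ∑ j ∈ arrived π (l + 1), u j := by
      rw [← Finset.add_sum_erase (arrived π (l + 1)) u (a := π ⟨l, hl⟩) (by simp [mem_arrived]),
        arrived_succ_erase, arrived_eq_map, Finset.sum_map]
      simp
    rw [h1, hu, ← Finset.sum_div, load, hcapβ, hμ]
    field_simp
  have hpt : ∀ π : Equiv.Perm (Fin n), Real.exp (lam *
      (I.load x f (arrived π (l + 1)) i - 1 - 3 * ε)) ≤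
      Real.exp (μ - lam - 3 * L) * Real.exp (μ * ∑ t ∈ positions n l, u (π t)) := by
    intro π
    rw [← Real.exp_add, Real.exp_le_exp, mul_sub, mul_sub, hload]
    have h1 : lam * (3 * ε) = 3 * L := by rw [hlamε, ← hεsq]; ring
    rw [h1]
    nlinarith [mul_le_mul_of_nonneg_left (hu1 (π ⟨l, hl⟩)) hμ0]
  have hmgf := sum_perm_exp_le h u hh hu0 hu1 huβ hμ0 ⟨l, hl⟩
  simp only [] at hmgf
  calc _ ≤ ∑ π : Equiv.Perm (Fin n), h (π ⟨l, hl⟩) *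
        (Real.exp (μ - lam - 3 * L) * Real.exp (μ * ∑ t ∈ positions n l, u (π t))) :=
        Finset.sum_le_sum fun π _ => mul_le_mul_of_nonneg_left (hpt π) (hh _)
    _ = Real.exp (μ - lam - 3 * L) * ∑ π : Equiv.Perm (Fin n), h (π ⟨l, hl⟩) *
        Real.exp (μ * ∑ t ∈ positions n l, u (π t)) := by
        rw [Finset.mul_sum]
        exact Finset.sum_congr rfl fun π _ => by ring
    _ ≤ Real.exp (μ - lam - 3 * L) * (Real.exp ((l + 1 : ℝ) / n * β * (Real.exp μ - 1)) *
        ∑ π : Equiv.Perm (Fin n), h (π ⟨l, hl⟩)) :=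
        mul_le_mul_of_nonneg_left hmgf (Real.exp_pos _).le
    _ ≤ _ := by
        rw [← mul_assoc, ← Real.exp_add]
        refine mul_le_mul_of_nonneg_right (Real.exp_le_exp.2 ?_) (Finset.sum_nonneg fun _ _ => hh _)
        rw [← hf]
        have h4 := (abs_le.1 (Real.abs_exp_sub_one_sub_id_le (x := μ)
          (by rw [abs_of_nonneg hμ0]; linarith))).2
        have h5 : f * β * (Real.exp μ - 1) ≤ f * β * (μ + μ ^ 2) :=
          mul_le_mul_of_nonneg_left (by linarith) (by positivity)
        have h6 : f * β * (μ + μ ^ 2) = lam + lam * μ := by rw [← hμlam]; ring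
        have h7 : lam * μ ≤ L := by
          rw [← hεsq, hlamε]
          nlinarith [mul_le_mul_of_nonneg_left hμε (mul_nonneg hε0 hB'0.le)]
        linarith

/-- On average, the optimum for the first `l + 1` requests with scaled capacities is almost the
proportional share of the value of any feasible solution. -/
theorem Solver.le_sum_perm_value_solution (sol : I.Solver) {x : Fin n → Fin K → ℝ}
    (hx : x ∈ I.feasible 1 Finset.univ) {d : ℕ} {B L : ℝ} (hd : I.ColumnSparse d)
    (hB0 : 0 < B) (hB : (B : EReal) ≤ I.capacityRatio) (hL : 1 ≤ L) (hdL : (d : ℝ) ≤ Real.exp L)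
    {l : ℕ} (hl : l < n) :
    (1 - 4 * √(L / (B * ((l + 1) / n)))) * (n.factorial / n * I.value x) ≤
      ((l : ℝ) + 1)⁻¹ * ∑ π, I.value (sol.solution (arrived π (l + 1))) := by
  have hn : (0 : ℝ) < n := by exact_mod_cast (show 0 < n by omega)
  have hcx : ∀ j k, 0 ≤ I.profit j k * x j k := fun j k =>
    mul_nonneg (I.profit_nonneg j k) (hx.2.1 j k)
  have hval0 : 0 ≤ I.value x := Finset.sum_nonneg fun j _ => Finset.sum_nonneg fun k _ => hcx j k
  set f : ℝ := (l + 1) / n with hf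
  have hf0 : 0 < f := by positivity
  -- If `B * f < L`, then the left-hand side is not positive.
  rcases lt_or_ge (B * f) L with hLB | hLB
  · refine le_trans (mul_nonpos_of_nonpos_of_nonneg ?_ (by positivity))
      (mul_nonneg (by positivity) (Finset.sum_nonneg fun π _ => sol.value_solution_nonneg _))
    have : 1 ≤ √(L / (B * f)) := Real.one_le_sqrt.2 ((one_le_div (by positivity)).2 hLB.le)
    linarith
  set B' : ℝ := B * f with hB'
  have hB'0 : 0 < B' := by positivity
  set ε : ℝ := √(L / B') with hε
  set lam : ℝ := √(L * B') with hlam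
  have hε0 : 0 ≤ ε := Real.sqrt_nonneg _
  have hlam0 : 0 < lam := Real.sqrt_pos.2 (by positivity)
  have hlamε : lam⁻¹ ≤ ε := by
    rw [inv_le_iff_one_le_mul₀ hlam0, hε, hlam, ← Real.sqrt_mul (by positivity),
      show L / B' * (L * B') = L ^ 2 by field_simp, Real.sqrt_sq (by linarith)]
    exact hL
  set W : ℝ := ∑ π : Equiv.Perm (Fin n), ∑ k, I.profit (π ⟨l, hl⟩) k * x (π ⟨l, hl⟩) k with hW
  have hWval : W = n.factorial / n * I.value x := by
    have := sum_perm_apply (fun j => ∑ k, I.profit j k * x j k) ⟨l, hl⟩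
    rw [div_mul_eq_mul_div, eq_div_iff hn.ne', mul_comm]
    exact this
  have hW0 : 0 ≤ W := by rw [hWval]; positivity
  let E : Equiv.Perm (Fin n) → Fin m → ℝ := fun π i =>
    Real.exp (lam * (I.load x f (arrived π (l + 1)) i - 1 - 3 * ε))
  let h : Fin m → Fin n → ℝ := fun i j =>
    ∑ k, if I.demand i j k ≠ 0 then I.profit j k * x j k else 0
  have hh : ∀ i j, 0 ≤ h i j := fun i j => Finset.sum_nonneg fun k _ => by
    split_ifs
    · exact hcx j k
    · rfl
  have h1 : ∑ π, ∑ j ∈ arrived π (l + 1), ∑ k, I.profit j k * x j k *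
      (1 - I.excess x f (3 * ε) lam (arrived π (l + 1)) j k) ≤
      ∑ π, I.value (sol.solution (arrived π (l + 1))) := by
    refine Finset.sum_le_sum fun π _ => ?_
    have := sol.le_value_solution hx (γ := 3 * ε) (by positivity) hlam0 (arrived π (l + 1))
    rw [card_arrived π hl] at this
    push_cast at this
    exact this
  rw [sum_perm_sum_arrived (hl := hl) fun π j => ∑ k, I.profit j k * x j k *
      (1 - I.excess x f (3 * ε) lam (arrived π (l + 1)) j k)] at h1
  swap
  · intro π s hs
    rw [arrived_mul_swap π hs (by simp)]
  rw [← hWval, le_inv_mul_iff₀ (by positivity)]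
  refine le_trans (mul_le_mul_of_nonneg_left ?_ (by positivity)) h1
  -- Exchanging the sums over options and resources, resource `i` carries the weight `h i` of the
  -- options that need it; by column sparsity these weights add up to at most `d` times the profit.
  have h2 : ∀ π : Equiv.Perm (Fin n), ∑ k, I.profit (π ⟨l, hl⟩) k * x (π ⟨l, hl⟩) k *
      (1 - I.excess x f (3 * ε) lam (arrived π (l + 1)) (π ⟨l, hl⟩) k) =
      (1 - 3 * ε) * (∑ k, I.profit (π ⟨l, hl⟩) k * x (π ⟨l, hl⟩) k) -
        lam⁻¹ * ∑ i, h i (π ⟨l, hl⟩) * E π i := by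
    intro π
    have h3 : ∑ i, h i (π ⟨l, hl⟩) * E π i = ∑ k, I.profit (π ⟨l, hl⟩) k * x (π ⟨l, hl⟩) k *
        ∑ i with I.demand i (π ⟨l, hl⟩) k ≠ 0, E π i := by
      simp only [h]
      simp_rw [Finset.sum_mul]
      rw [Finset.sum_comm]
      refine Finset.sum_congr rfl fun k _ => ?_
      rw [Finset.sum_filter, Finset.mul_sum]
      refine Finset.sum_congr rfl fun i _ => ?_
      split_ifs <;> simp
    rw [h3, Finset.mul_sum, Finset.mul_sum, ← Finset.sum_sub_distrib]
    refine Finset.sum_congr rfl fun k _ => ?_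
    simp only [excess, E]
    rw [← Finset.sum_div]
    ring
  have h4 : ∀ i, ∑ π : Equiv.Perm (Fin n), h i (π ⟨l, hl⟩) * E π i ≤
      Real.exp (-L) * ∑ π : Equiv.Perm (Fin n), h i (π ⟨l, hl⟩) := by
    intro i
    by_cases hi : 0 < I.maxDemand i
    · exact sum_perm_exp_load_le hx hB0 hB hL hl hLB hi (hh i)
    · have h5 : ∀ j, h i j = 0 := by
        intro j
        refine Finset.sum_eq_zero fun k _ => if_neg fun hne => hi (maxDemand_pos hne)
      simp [h5]
  have h5 : ∑ i, ∑ π : Equiv.Perm (Fin n), h i (π ⟨l, hl⟩) ≤ d * W := by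
    rw [Finset.sum_comm, hW, Finset.mul_sum]
    refine Finset.sum_le_sum fun π _ => ?_
    simp only [h]
    rw [Finset.sum_comm, Finset.mul_sum]
    refine Finset.sum_le_sum fun k _ => ?_
    rw [← Finset.sum_filter, Finset.sum_const, nsmul_eq_mul]
    exact mul_le_mul_of_nonneg_right (by exact_mod_cast hd _ k) (hcx _ k)
  have h6 : ∑ π, ∑ i, h i (π ⟨l, hl⟩) * E π i ≤ W := by
    rw [Finset.sum_comm]
    refine (Finset.sum_le_sum fun i _ => h4 i).trans ?_
    rw [← Finset.mul_sum]
    refine (mul_le_mul_of_nonneg_left h5 (Real.exp_pos _).le).trans ?_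
    rw [← mul_assoc]
    refine mul_le_of_le_one_left hW0 ?_
    rw [Real.exp_neg, inv_mul_le_iff₀ (Real.exp_pos _), mul_one]
    exact hdL
  rw [Finset.sum_congr rfl fun π _ => h2 π, Finset.sum_sub_distrib, ← Finset.mul_sum,
    ← Finset.mul_sum]
  have h7 : lam⁻¹ * ∑ π, ∑ i, h i (π ⟨l, hl⟩) * E π i ≤ ε * W :=
    (mul_le_mul_of_nonneg_left h6 (by positivity)).trans (mul_le_mul_of_nonneg_right hlamε hW0)
  change (1 - 4 * ε) * W ≤ (1 - 3 * ε) * W - _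
  linarith

/-! ### Summation over the arrival times -/

theorem sum_inv_sqrt_le (n : ℕ) : ∑ l ∈ Finset.range n, (√((l : ℝ) + 1))⁻¹ ≤ 2 * √n := by
  induction n with
  | zero => simp
  | succ n ih =>
    rw [Finset.sum_range_succ]
    push_cast
    have h0 : 0 < √((n : ℝ) + 1) := Real.sqrt_pos.2 (by positivity)
    have h1 : √(n : ℝ) ≤ √((n : ℝ) + 1) := Real.sqrt_le_sqrt (by linarith)
    have h2 : √((n : ℝ) + 1) ^ 2 = n + 1 := Real.sq_sqrt (by positivity)
    have h3 : √(n : ℝ) ^ 2 = n := Real.sq_sqrt (by positivity)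
    have h4 : (√((n : ℝ) + 1))⁻¹ ≤ 2 * (√((n : ℝ) + 1) - √n) := by
      rw [inv_le_iff_one_le_mul₀ h0]
      nlinarith [Real.sqrt_nonneg (n : ℝ)]
    linarith

theorem sum_sampling_loss_le {B L : ℝ} (hB : 0 < B) (n : ℕ) :
    ∑ l ∈ Finset.range n, √(L / (B * (((l : ℝ) + 1) / n))) ≤ 2 * n * √(L / B) := by
  have h1 : ∀ l ∈ Finset.range n, √(L / (B * (((l : ℝ) + 1) / n))) =
      √(L / B) * √n * (√((l : ℝ) + 1))⁻¹ := by
    intro l hl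
    have hn : (0 : ℝ) < n := by
      exact_mod_cast (show 0 < n by have := Finset.mem_range.1 hl; omega)
    rw [← Real.sqrt_inv, ← Real.sqrt_mul' _ hn.le, ← Real.sqrt_mul' _ (by positivity)]
    congr 1
    field_simp
  rw [Finset.sum_congr rfl h1, ← Finset.mul_sum]
  have h2 := mul_le_mul_of_nonneg_left (sum_inv_sqrt_le n)
    (mul_nonneg (Real.sqrt_nonneg (L / B)) (Real.sqrt_nonneg (n : ℝ)))
  have h3 : √(n : ℝ) ^ 2 = n := Real.sq_sqrt (by positivity)
  refine h2.trans (le_of_eq ?_)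
  linear_combination 2 * √(L / B) * h3

theorem rejectionBound_nonneg (n d : ℕ) (B : ℝ) (l : ℕ) : 0 ≤ rejectionBound n d B l := by
  unfold rejectionBound; positivity

theorem rejectionBound_le_one (n d : ℕ) (B : ℝ) (l : ℕ) : rejectionBound n d B l ≤ 1 :=
  min_le_left _ _

/-- Once the remaining time is a large multiple of `√(L / B)`, the Gaussian tail outweighs the
factor `d`. -/
theorem rejectionBound_le_inv_sq {d : ℕ} {B L : ℝ} (hB : 0 < B) (hdL : (d : ℝ) ≤ Real.exp L)
    {n s : ℕ} (hs0 : 0 < s) (hsn : s ≤ n) (hs : n * √(8 * L / B) ≤ s) :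
    rejectionBound n d B (n - s) ≤ 24 * n ^ 2 / B * ((s : ℝ) ^ 2)⁻¹ := by
  have hn : (0 : ℝ) < n := by exact_mod_cast hs0.trans_le hsn
  have hs' : (0 : ℝ) < s := by exact_mod_cast hs0
  have h1 : 1 - ((n - s : ℕ) : ℝ) / n = s / n := by
    rw [Nat.cast_sub hsn]; field_simp; ring
  refine (min_le_right _ _).trans ?_
  rw [h1]
  set q : ℝ := (s / n : ℝ) ^ 2 * B / 8 with hq
  have hq0 : 0 < q := by positivity
  have hLq : L ≤ q := by
    have h2 : √(8 * L / B) ≤ s / n := by rw [le_div_iff₀ hn, mul_comm]; exact hs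
    have h3 := (Real.sqrt_le_left (by positivity)).1 h2
    rw [div_le_iff₀ hB] at h3
    rw [hq]; linarith
  have h4 : Real.exp (-((s / n : ℝ) ^ 2 * B / 4)) = Real.exp (-q) * Real.exp (-q) := by
    rw [← Real.exp_add]; congr 1; rw [hq]; ring
  have h5 : d * Real.exp (-q) ≤ 1 := by
    rw [Real.exp_neg, mul_inv_le_iff₀ (Real.exp_pos _), one_mul]
    exact hdL.trans (Real.exp_le_exp.2 hLq)
  have h6 : Real.exp (-q) ≤ q⁻¹ := by
    rw [Real.exp_neg]
    exact inv_anti₀ hq0 (by linarith [Real.add_one_le_exp q])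
  rw [h4]
  calc 3 * (d : ℝ) * (Real.exp (-q) * Real.exp (-q)) =
        3 * ((d * Real.exp (-q)) * Real.exp (-q)) := by ring
    _ ≤ 3 * q⁻¹ := by
        refine mul_le_mul_of_nonneg_left ?_ (by norm_num)
        exact (mul_le_of_le_one_left (Real.exp_pos _).le h5).trans h6
    _ = _ := by rw [hq]; field_simp; norm_num

theorem sum_rejectionBound_le {d : ℕ} {B L : ℝ} (hB : 0 < B) (hL : 1 ≤ L)
    (hdL : (d : ℝ) ≤ Real.exp L) (n : ℕ) :
    ∑ l ∈ Finset.range n, rejectionBound n d B l ≤ 21 * n * √(L / B) := by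
  rcases Nat.eq_zero_or_pos n with rfl | hn0
  · simp
  have hn : (0 : ℝ) < n := by exact_mod_cast hn0
  set T : ℝ := √(8 * L / B) with hT
  have hT0 : 0 < T := Real.sqrt_pos.2 (by positivity)
  have hTsq : B * T ^ 2 = 8 * L := by
    rw [hT, Real.sq_sqrt (by positivity)]; field_simp
  have hT3 : T ≤ 3 * √(L / B) := by
    rw [hT, Real.sqrt_le_left (by positivity), mul_pow, Real.sq_sqrt (by positivity), mul_div_assoc]
    have : 0 ≤ L / B := by positivity
    linarith
  -- The last `N` arrivals are written off; for the others the bounds are summed.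
  set N : ℕ := ⌊n * T⌋₊ with hN
  -- The sum runs over the remaining time `s = n - l`.
  have hreflect : ∑ l ∈ Finset.range n, rejectionBound n d B l =
      ∑ s ∈ Finset.Ioo 0 (n + 1), rejectionBound n d B (n - s) := by
    refine Finset.sum_bij' (fun l _ => n - l) (fun s _ => n - s) ?_ ?_ ?_ ?_ ?_ <;>
      simp only [Finset.mem_range, Finset.mem_Ioo] <;> intro a ha
    · omega
    · omega
    · omega
    · omega
    · congr 1; omega
  have hpt : ∀ s ∈ Finset.Ioo 0 (n + 1), rejectionBound n d B (n - s) ≤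
      if s ≤ N then 1 else 24 * n ^ 2 / B * ((s : ℝ) ^ 2)⁻¹ := by
    intro s hs
    rw [Finset.mem_Ioo] at hs
    split_ifs with h
    · exact rejectionBound_le_one _ _ _ _
    · exact rejectionBound_le_inv_sq hB hdL hs.1 (by omega)
        (Nat.lt_of_floor_lt (not_le.1 h)).le
  rw [hreflect]
  refine (Finset.sum_le_sum hpt).trans ?_
  rw [Finset.sum_ite, ← Finset.mul_sum, Finset.sum_const, nsmul_eq_mul, mul_one]
  have h1 : (((Finset.Ioo 0 (n + 1)).filter fun s => s ≤ N).card : ℝ) ≤ n * T := by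
    refine le_trans ?_ (Nat.floor_le (by positivity : 0 ≤ n * T))
    rw [← hN]
    have : ((Finset.Ioo 0 (n + 1)).filter fun s => s ≤ N) ⊆ Finset.Ioc 0 N := by
      intro s; simp only [Finset.mem_filter, Finset.mem_Ioo, Finset.mem_Ioc]; omega
    have := Finset.card_le_card this
    rw [Nat.card_Ioc, Nat.sub_zero] at this
    exact_mod_cast this
  have h2 : ∑ s ∈ (Finset.Ioo 0 (n + 1)).filter (fun s => ¬s ≤ N), ((s : ℝ) ^ 2)⁻¹ ≤
      2 / (N + 1) := by
    refine le_trans (Finset.sum_le_sum_of_subset_of_nonneg ?_ fun _ _ _ => by positivity)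
      (sum_Ioo_inv_sq_le N (n + 1))
    intro s; simp only [Finset.mem_filter, Finset.mem_Ioo]; omega
  have h3 : (2 : ℝ) / (N + 1) ≤ 2 / (n * T) :=
    div_le_div_of_nonneg_left (by norm_num) (by positivity) (Nat.lt_floor_add_one _).le
  have h4 : 24 * (n : ℝ) ^ 2 / B * (2 / (n * T)) = n * (48 / (B * T)) := by field_simp; norm_num
  have h5 : 48 / (B * T) ≤ 6 * T := by
    rw [div_le_iff₀ (by positivity)]; nlinarith
  have h6 := mul_le_mul_of_nonneg_left (h2.trans h3) (by positivity : 0 ≤ 24 * (n : ℝ) ^ 2 / B)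
  rw [h4] at h6
  have h7 := mul_le_mul_of_nonneg_left h5 hn.le
  have h8 := mul_le_mul_of_nonneg_left hT3 hn.le
  linarith

end PackingLP

theorem one_le_log2Max (d : ℕ) : 1 ≤ log2Max d := le_max_right _ _

theorem le_exp_log2Max (d : ℕ) : (d : ℝ) ≤ Real.exp (log2Max d) := by
  rcases Nat.eq_zero_or_pos d with rfl | hd
  · simpa using (Real.exp_pos _).le
  have hd1 : (1 : ℝ) ≤ d := by exact_mod_cast hd
  rw [← Real.log_le_iff_le_exp (by linarith)]
  refine le_trans ?_ (le_max_left _ _)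
  rw [Real.logb, le_div_iff₀ (Real.log_pos (by norm_num))]
  exact mul_le_of_le_one_right (Real.log_nonneg hd1) (Real.log_two_lt_d9.le.trans (by norm_num))

namespace PackingLP

variable {m n K : ℕ} {I : PackingLP m n K}

/-! ### The competitive ratio -/

theorem IsOptimal.value_eq_opt {x : Fin n → Fin K → ℝ} (hx : I.IsOptimal 1 Finset.univ x) :
    I.value x = I.opt :=
  (IsGreatest.csSup_eq ⟨Set.mem_image_of_mem _ hx.1, Set.forall_mem_image.2 hx.2⟩).symm

theorem opt_nonneg (I : PackingLP m n K) : 0 ≤ I.opt := by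
  obtain ⟨x, hx⟩ := I.exists_isOptimal zero_le_one Finset.univ
  rw [← hx.value_eq_opt]
  exact Finset.sum_nonneg fun j _ => Finset.sum_nonneg fun k _ =>
    mul_nonneg (I.profit_nonneg j k) (hx.1.2.1 j k)

/-- The competitive ratio in terms of any `L ≥ 1` with `d ≤ exp L`. In every step the losses from
sampling and from rejections are at most added up. -/
theorem Solver.le_expectedProfit (sol : I.Solver) {d : ℕ} {B L : ℝ} (hd : I.ColumnSparse d)
    (hB0 : 0 < B) (hB : (B : EReal) ≤ I.capacityRatio) (hL : 1 ≤ L)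
    (hdL : (d : ℝ) ≤ Real.exp L) : (1 - 29 * √(L / B)) * I.opt ≤ sol.expectedProfit := by
  obtain ⟨x, hx⟩ := I.exists_isOptimal zero_le_one Finset.univ
  have hopt := hx.value_eq_opt
  have hopt0 := I.opt_nonneg
  rcases Nat.eq_zero_or_pos n with rfl | hn0
  · have h0 : I.opt = 0 := by rw [← hopt]; simp [value]
    rw [h0, mul_zero]
    exact Finset.sum_nonneg fun y _ => by simp [value]
  have hn : (0 : ℝ) < n := by exact_mod_cast hn0
  set W : ℝ := n.factorial / n * I.opt with hW
  have hW0 : 0 ≤ W := by positivity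
  have key : ∀ k ≤ n, (∑ l ∈ Finset.range k, (1 - rejectionBound n d B l -
      4 * √(L / (B * (((l : ℝ) + 1) / n))))) * W ≤
      ∑ π, sol.orderMean k (arrived π k) fun y => I.value (toVector y) := by
    intro k
    induction k with
    | zero => simp [Solver.orderMean_zero, value, toVector]
    | succ l ih =>
      intro hl
      have h1 := ih (by omega)
      have h2 := sol.le_sum_perm_orderMean_succ_value hd hB hl
      have h3 := sol.le_sum_perm_value_solution hx.1 hd hB0 hB hL hdL hl
      rw [hopt, ← hW] at h3
      have h4 : 0 ≤ ((l : ℝ) + 1)⁻¹ * ∑ π, I.value (sol.solution (arrived π (l + 1))) :=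
        mul_nonneg (by positivity) (Finset.sum_nonneg fun π _ => sol.value_solution_nonneg _)
      have h5 := rejectionBound_nonneg n d B l
      have h6 := rejectionBound_le_one n d B l
      rw [Finset.sum_range_succ, add_mul]
      set p := rejectionBound n d B l
      set ε := √(L / (B * (((l : ℝ) + 1) / n)))
      have hε : 0 ≤ ε := Real.sqrt_nonneg _
      -- This also holds when `1 - 4 * ε` is negative.
      have h7 : (1 - p - 4 * ε) * W ≤ (1 - p) * ((1 - 4 * ε) * W) := by
        have : 0 ≤ p * ε * W := by positivity
        nlinarith
      have h8 := mul_le_mul_of_nonneg_left h3 (sub_nonneg.2 h6)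
      linarith
  have h1 := key n le_rfl
  simp_rw [arrived_eq_univ] at h1
  rw [← Solver.expectedProfit_eq, Finset.sum_const, nsmul_eq_mul, Finset.card_univ,
    Fintype.card_perm, Fintype.card_fin, Finset.sum_sub_distrib, Finset.sum_sub_distrib,
    ← Finset.mul_sum] at h1
  have h2 := sum_rejectionBound_le hB0 hL hdL n
  have h3 := sum_sampling_loss_le (L := L) hB0 n
  have h4 : (n : ℝ) * (1 - 29 * √(L / B)) ≤ ∑ _l ∈ Finset.range n, (1 : ℝ) -
      ∑ l ∈ Finset.range n, rejectionBound n d B l -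
      4 * ∑ l ∈ Finset.range n, √(L / (B * (((l : ℝ) + 1) / n))) := by
    rw [Finset.sum_const, Finset.card_range, nsmul_eq_mul]
    linarith
  have h5 := (mul_le_mul_of_nonneg_right h4 hW0).trans h1
  have h6 : (n : ℝ) * (1 - 29 * √(L / B)) * W =
      n.factorial * ((1 - 29 * √(L / B)) * I.opt) := by
    rw [hW]; field_simp
  rw [h6] at h5
  exact le_of_mul_le_mul_left h5 (by positivity)

end PackingLP

end

theorem mainTheorem1 :
    ∃ C : ℝ, 0 < C ∧
      ∀ (m n K d : ℕ) (I : PackingLP m n K) (sol : I.Solver) (B : ℝ),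
        I.ColumnSparse d → 0 < B → (B : EReal) ≤ I.capacityRatio →
          (∀ y ∈ sol.output.support, PackingLP.toVector y ∈ I.feasible 1 Finset.univ) ∧
          (1 - C * √(log2Max d / B)) * I.opt ≤ sol.expectedProfit := by
  refine ⟨29, by norm_num, fun m n K d I sol B hd hB0 hB => ⟨fun y hy => ?_, ?_⟩⟩
  · exact sol.feasible_of_mem_support_output hy
  · exact sol.le_expectedProfit hd hB0 hB (one_le_log2Max d) (le_exp_log2Max d)
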